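/- **Notation.** Let $\mathbb H$ be the upper half plane, $z=x+iy\in\mathbb H$, $\Gamma=\mathrm{SL}_2(\mathbb Z)$, $\Gamma_\infty=\{\pm\left(\begin{smallmatrix}1&n\\0&1\end{smallmatrix}\right):n\in\mathbb Z\}$, and $j(\gamma,z)=cz+d$ for $\gamma\in\Gamma$ with bottom row $(c,d)$. For $k\in2\mathbb Z$ put $$E_k(z,s)=\sum_{\gamma\in\Gamma_\infty\backslash\Gamma}\left(\frac{j(\gamma,z)}{|j(\gamma,z)|}\right)^{-k}\operatorname{Im}(\gamma z)^s\quad(\operatorname{Re}s>1),\qquad \theta_k(s)=\pi^{-s}\,\Gamma(s+|k|/2)\,\zeta(2s),$$ where $\theta_k$ is regarded as a meromorphic function on $\mathbb C$. Let $E^*_k(z,s)$ be the analytic continuation in $s$ of $\theta_k(s)E_k(z,s)$; it exists on $\mathbb C$ if $k\neq0$ and on $\mathbb C\setminus\{0,1\}$ if $k=0$. Let $\sigma_w(m)=\sum_{d\mid m}d^w$. For $h\in\mathbb Z$ put $h^*=|h-1/2|-1/2$, so $h^*=h-1$ if $h\ge1$ and $h^*=-h$ if $h\le0$. For $u\in\mathbb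 Z_{\ge0}$ put $$\mathcal A^k_h(u)=\begin{cases}(-1)^{u+k/2}\,u!\,\binom{k/2+h-1}{u}\binom{k/2-h}{u}, & k\ge0,\\[4pt] (-1)^u\,\dfrac{[(u-k/2)!]^2}{u!}\binom{h-1}{u-k/2}\binom{-h}{u-k/2}, & k\le0,\end{cases}$$ with generalized binomial coefficients $\binom an=a(a-1)\cdots(a-n+1)/n!$. A sum $\sum_{u=0}^N$ with $N<0$ is empty. **Theorem 1.2.** Let $h\in\mathbb Z$ and $k\in2\mathbb Z$ with $(h,k)\neq(0,0),(1,0)$. The numbers $\mathcal A^{k}_h(u)$ and $\mathcal A^{-k}_h(u)$ are integers, and for all $z\in\mathbb H$ $$\begin{aligned}E^*_k(z,h)={}&\theta_k(h)y^h+\theta_k(1-h)y^{1-h}+\sum_{m=1}^\infty\frac{\sigma_{2h-1}(m)}{m^h}e^{2\pi imz}\sum_{u=0}^{h^*+k/2}\mathcal A^k_h(u)(4\pi my)^{-u+k/2}\\&+\sum_{m=1}^\infty\frac{\sigma_{2h-1}(m)}{m^h}e^{-2\pi im\bar z}\sum_{u=0}^{h^*-k/2}\mathcal A^{-k}_h(u)(4\pi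 my)^{-u-k/2},\end{aligned}$$ where both series over $m$ converge absolutely. The upper limits of the inner sums may be reduced, because of vanishing coefficients, exactly in the following cases. If $h^*<k/2$, the upper limit $h^*+k/2$ of the first inner sum may be reduced to $k/2-1-h^*$. If $h^*<-k/2$, the upper limit $h^*-k/2$ of the second inner sum may be reduced to $-k/2-1-h^*$. Precisely, for $0\le u\le h^*+k/2$ one has $\mathcal A^k_h(u)=0$ if and only if $h^*<k/2$ and $u>k/2-1-h^*$, and for $0\le u\le h^*-k/2$ one has $\mathcal A^{-k}_h(u)=0$ if and only if $h^*<-k/2$ and $u>-k/2-1-h^*$. -/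

import Mathlib

open scoped UpperHalfPlane MatrixGroups Nat

namespace NonholoEisenstein

noncomputable section

/-- The subgroup `Γ_∞ = {± (1 n; 0 1) : n ∈ ℤ}` of `Γ = SL(2, ℤ)`. -/
def gammaInfty : Subgroup SL(2, ℤ) where
  carrier := {γ | ∃ n : ℤ, γ = ModularGroup.T ^ n ∨ γ = -ModularGroup.T ^ n}
  mul_mem' := by
    rintro a b ⟨m, hm⟩ ⟨n, hn⟩
    refine ⟨m + n, ?_⟩
    rcases hm with rfl | rfl <;> rcases hn with rfl | rfl <;> simp [zpow_add]
  one_mem' := ⟨0, by simp⟩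
  inv_mem' := by
    rintro a ⟨n, hn⟩
    refine ⟨-n, ?_⟩
    rcases hn with rfl | rfl
    · left; simp
    · right
      rw [inv_eq_iff_mul_eq_one]
      simp

/-- The set `Γ_∞ \ Γ` of cosets `Γ_∞ γ`. -/
abbrev Cosets : Type := Quotient (QuotientGroup.rightRel gammaInfty)

/-- The factor `j(γ, z) = c z + d`, where `(c, d)` is the bottom row of `γ`. -/
def autFactor (γ : SL(2, ℤ)) (z : ℍ) : ℂ := (γ 1 0 : ℂ) * (z : ℂ) + (γ 1 1 : ℂ)

/-- The summand `(j(γ, z) / |j(γ, z)|) ^ (-k) * Im (γ z) ^ s` of the Eisenstein series. -/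
def eisensteinTerm (k : ℤ) (z : ℍ) (s : ℂ) (γ : SL(2, ℤ)) : ℂ :=
  (autFactor γ z / (‖autFactor γ z‖ : ℂ)) ^ (-k) * ((γ • z).im : ℂ) ^ s

/-- The summand attached to a coset; for even `k` it does not depend on the representative, see
`eisensteinTerm_eq_of_rightRel`. -/
def eisensteinCosetTerm (k : ℤ) (z : ℍ) (s : ℂ) (q : Cosets) : ℂ :=
  eisensteinTerm k z s q.out

/-- The series `E_k(z, s) = ∑_{γ ∈ Γ_∞ \ Γ} (j(γ, z) / |j(γ, z)|) ^ (-k) Im (γ z) ^ s`, used for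
`Re s > 1`. -/
def eisenstein (k : ℤ) (z : ℍ) (s : ℂ) : ℂ := ∑' q : Cosets, eisensteinCosetTerm k z s q

/-- `θ_k(s)`, the value at `s` of the meromorphic function `π ^ (-s) Γ(s + |k|/2) ζ(2 s)`.
The limit is there because at some integers a pole of `Γ` cancels against a zero of `ζ`. -/
def thetaK (k : ℤ) (s : ℂ) : ℂ :=
  Filter.limUnder (nhdsWithin s {s}ᶜ) fun w : ℂ =>
    (Real.pi : ℂ) ^ (-w) * Complex.Gamma (w + ((k.natAbs / 2 : ℕ) : ℂ)) * riemannZeta (2 * w)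

/-- The set on which `s ↦ E*_k(z, s)` is holomorphic: `ℂ` if `k ≠ 0`, and `ℂ \ {0, 1}` if
`k = 0`. -/
def continuationDomain (k : ℤ) : Set ℂ := {s | k = 0 → s ≠ 0 ∧ s ≠ 1}

/-- `F` is the analytic continuation of `s ↦ θ_k(s) E_k(z, s)` from the half plane `Re s > 1`. -/
structure IsCompletedEisenstein (k : ℤ) (z : ℍ) (F : ℂ → ℂ) : Prop where
  holomorphic : DifferentiableOn ℂ F (continuationDomain k)
  eq_of_one_lt_re : ∀ s : ℂ, 1 < s.re → F s = thetaK k s * eisenstein k z s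

open Classical in
/-- The completed Eisenstein series `E*_k(z, s)`, as a function of `s`: the analytic continuation
of `θ_k(s) E_k(z, s)`. -/
def completedEisenstein (k : ℤ) (z : ℍ) : ℂ → ℂ :=
  if hF : ∃ F : ℂ → ℂ, IsCompletedEisenstein k z F then hF.choose else 0

/-- The divisor power sum `σ_w(m) = ∑_{d ∣ m} d ^ w` for an integer `w`. -/
def divisorPowerSum (w : ℤ) (m : ℕ) : ℂ := ∑ d ∈ m.divisors, (d : ℂ) ^ w

/-- `h* = |h - 1/2| - 1/2`. -/
def hStar (h : ℤ) : ℤ := if 1 ≤ h then h - 1 else -h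

/-- The coefficient `𝒜^k_h(u)` for even `k`. `Ring.choose` is the generalized binomial
coefficient `a (a - 1) ⋯ (a - n + 1) / n!`. -/
def coeffA (k h : ℤ) (u : ℕ) : ℚ :=
  if 0 ≤ k then
    (-1 : ℚ) ^ ((u : ℤ) + k / 2) * (u ! : ℚ) *
      ((Ring.choose (k / 2 + h - 1 : ℤ) u : ℤ) : ℚ) * ((Ring.choose (k / 2 - h : ℤ) u : ℤ) : ℚ)
  else
    (-1 : ℚ) ^ u * ((((u : ℤ) - k / 2).toNat ! : ℚ) ^ 2 / (u ! : ℚ)) *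
      ((Ring.choose (h - 1 : ℤ) ((u : ℤ) - k / 2).toNat : ℤ) : ℚ) *
      ((Ring.choose (-h : ℤ) ((u : ℤ) - k / 2).toNat : ℤ) : ℚ)

/-- The inner sum `∑_{u = 0}^{N} 𝒜^k_h(u) x ^ (-u + k/2)`, which is empty if `N < 0`. -/
def innerSum (k h N : ℤ) (x : ℝ) : ℂ :=
  ∑ u ∈ Finset.range (N + 1).toNat, (coeffA k h u : ℂ) * (x : ℂ) ^ (-(u : ℤ) + k / 2)

/-- The `m`-th term of the first series, with upper limit `N` in the inner sum. -/
def posTerm (k h N : ℤ) (z : ℍ) (m : ℕ+) : ℂ :=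
  divisorPowerSum (2 * h - 1) m / (m : ℂ) ^ h *
    Complex.exp (2 * Real.pi * Complex.I * (m : ℂ) * (z : ℂ)) *
    innerSum k h N (4 * Real.pi * (m : ℝ) * z.im)

/-- The `m`-th term of the second series, with upper limit `N` in the inner sum. -/
def negTerm (k h N : ℤ) (z : ℍ) (m : ℕ+) : ℂ :=
  divisorPowerSum (2 * h - 1) m / (m : ℂ) ^ h *
    Complex.exp (-(2 * Real.pi * Complex.I * (m : ℂ) * (starRingEnd ℂ) (z : ℂ))) *
    innerSum (-k) h N (4 * Real.pi * (m : ℝ) * z.im)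

/-- The Fourier expansion of `E*_k(z, h)`, with upper limits `N₁` and `N₂` in the two inner sums;
both series converge absolutely. -/
def HasFourierExpansion (k h N₁ N₂ : ℤ) (z : ℍ) : Prop :=
  Summable (posTerm k h N₁ z) ∧ Summable (negTerm k h N₂ z) ∧
  completedEisenstein k z (h : ℂ) =
    thetaK k (h : ℂ) * (z.im : ℂ) ^ h + thetaK k (1 - (h : ℂ)) * (z.im : ℂ) ^ (1 - h)
      + ∑' m : ℕ+, posTerm k h N₁ z m + ∑' m : ℕ+, negTerm k h N₂ z m

/-- The summand of the Eisenstein series of even weight depends only on the coset `Γ_∞ γ`. -/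
theorem eisensteinTerm_eq_of_rightRel {k : ℤ} (hk : Even k) (z : ℍ) (s : ℂ) {γ γ' : SL(2, ℤ)}
    (hr : QuotientGroup.rightRel gammaInfty γ γ') :
    eisensteinTerm k z s γ = eisensteinTerm k z s γ' := by
  rw [QuotientGroup.rightRel_apply] at hr
  obtain ⟨n, hn⟩ := hr
  have key : ∀ δ : SL(2, ℤ), autFactor (ModularGroup.T ^ n * δ) z = autFactor δ z := by
    intro δ
    have h0 : (ModularGroup.T ^ n * δ) 1 = δ 1 := by
      ext j
      simp
    simp [autFactor, h0]
  have keyim : ∀ δ : SL(2, ℤ), ((ModularGroup.T ^ n * δ) • z).im = (δ • z).im := by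
    intro δ
    rw [mul_smul, UpperHalfPlane.modular_T_zpow_smul]
    simp
  rcases hn with hn | hn
  · have : γ' = ModularGroup.T ^ n * γ := by rw [← hn]; simp
    subst this
    simp only [eisensteinTerm, key, keyim]
  · have : γ' = -(ModularGroup.T ^ n * γ) := by rw [← neg_mul, ← hn]; simp
    subst this
    have hj : autFactor (-(ModularGroup.T ^ n * γ)) z = -autFactor γ z := by
      rw [← key γ]; simp only [autFactor, Matrix.SpecialLinearGroup.coe_neg, Matrix.neg_apply]
      push_cast; ring
    have hi : ((-(ModularGroup.T ^ n * γ)) • z).im = (γ • z).im := by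
      rw [ModularGroup.SL_neg_smul, keyim]
    simp only [eisensteinTerm, hj, hi, norm_neg, neg_div]
    rw [hk.neg.neg_zpow]

/-- The analytic continuation is unique. -/
theorem IsCompletedEisenstein.eqOn {k : ℤ} {z : ℍ} {F G : ℂ → ℂ}
    (hF : IsCompletedEisenstein k z F) (hG : IsCompletedEisenstein k z G) :
    Set.EqOn F G (continuationDomain k) := by
  have hc : continuationDomain k = (if k = 0 then ({0, 1} : Set ℂ) else ∅)ᶜ := by
    ext s
    by_cases h : k = 0 <;> simp [continuationDomain, h]
  have hfin : (if k = 0 then ({0, 1} : Set ℂ) else ∅).Finite := by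
    split_ifs <;> simp
  have hopen : IsOpen (continuationDomain k) := by
    rw [hc]; exact hfin.isClosed.isOpen_compl
  have hconn : IsPreconnected (continuationDomain k) := by
    rw [hc]
    exact (hfin.countable.isPathConnected_compl_of_one_lt_rank
      (by simp [Complex.rank_real_complex])).isConnected.isPreconnected
  have h2 : (2 : ℂ) ∈ continuationDomain k := by
    intro _
    norm_num
  refine (hF.holomorphic.analyticOnNhd hopen).eqOn_of_preconnected_of_eventuallyEq
    (hG.holomorphic.analyticOnNhd hopen) hconn h2 ?_
  have : {s : ℂ | 1 < s.re} ∈ nhds (2 : ℂ) :=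
    (isOpen_lt continuous_const Complex.continuous_re).mem_nhds (by simp)
  filter_upwards [this] with s hs
  rw [hF.eq_of_one_lt_re s hs, hG.eq_of_one_lt_re s hs]

end

end NonholoEisenstein

open NonholoEisenstein

/-! Put κ = k/2. Then θ_k(s) = (s)_{|κ|} Λ(2s), and ζ(2s) E_k(z, s) is y^s times half the sum of
(w/|w|)^(-k) |w|^(-2s) over the nonzero lattice points w = cz + d (`zeta_mul_eisenstein`). The row c
= 0 yields θ_k(s) y^s. In a row c ≥ 1 the summand is, up to a constant, a product of complex powers
of w and its conjugate with exponents -(s+κ) and -(s-κ). Each power is the Fourier transform of some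
t^(α-1) e^(2πiτt) on the half line, so the product is the transform of their correlation, and
Poisson summation applies (`tsum_latticeTerm_add_int`). The correlation at m = 0 is a Gamma
integral; at m ≠ 0 it is Tricomi's confluent hypergeometric function `tricomi`. Summed over c, the
zero modes become θ_k(1-s) y^(1-s) by the functional equation and the duplication formula
(`thetaReg_one_sub`).

This holds for Re s > |κ| + 1. Now `tricomi` is entire in its parameters and of polynomial growth in
x, so the nonconstant part is entire in s. The constant part is holomorphic, except at 0 and 1 when
k = 0. By the identity theorem the formula is the continuation (`isCompletedEisenstein_two_mul`).

At s = h the parameters of `tricomi` are a = h-κ and c = h+κ-1. Its asymptotic series terminates,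
and is then exact, unless a > 0 > c; in that case the polynomial factor `gammaQuot` vanishes and the
inner sum is empty (`gammaQuot_mul_tricomi_eq_innerSum`). Collecting the pairs (c, m) with the same
product produces the divisor sums (`hasSum_fourierTerm`). For κ ≥ 0 the two binomials in the
coefficient have upper entries κ+h* and κ-1-h*, from which the vanishing is read off
(`coeffA_eq_zero_iff`). -/

namespace NonholoEisenstein
-- Holomorphic parameter integrals and the complex Laplace integral.
open MeasureTheory Set Filter Topology

/-- A bound on the integrand alone suffices: Cauchy's estimate on discs of radius r/4 turns it into
the bound g/(r/4) for the s-derivative. -/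
theorem differentiableOn_integral_of_dominated {α : Type*} [MeasurableSpace α] {μ : Measure α}
    {U : Set ℂ} (hU : IsOpen U) {F : ℂ → α → ℂ} {g : α → ℝ} (hg : Integrable g μ)
    (hmeas : ∀ s ∈ U, AEStronglyMeasurable (F s) μ)
    (hd : ∀ᵐ a ∂μ, DifferentiableOn ℂ (fun s => F s a) U)
    (hb : ∀ᵐ a ∂μ, ∀ s ∈ U, ‖F s a‖ ≤ g a) :
    DifferentiableOn ℂ (fun s => ∫ a, F s a ∂μ) U := by
  intro s hs
  obtain ⟨r, hr, hrU⟩ := Metric.isOpen_iff.1 hU s hs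
  have hball : ∀ w ∈ Metric.ball s (r / 2), Metric.closedBall w (r / 4) ⊆ U := by
    intro w hw v hv
    apply hrU
    rw [Metric.mem_ball] at hw ⊢
    rw [Metric.mem_closedBall] at hv
    linarith [dist_triangle v w s]
  have hsU : Metric.ball s (r / 2) ⊆ U := fun w hw =>
    hball w hw (Metric.mem_closedBall_self (by positivity))
  have hderiv : ∀ᵐ a ∂μ, ∀ w ∈ Metric.ball s (r / 2),
      HasDerivAt (fun w => F w a) (deriv (fun w => F w a) w) w := by
    filter_upwards [hd] with a ha w hw
    exact (ha.differentiableAt (hU.mem_nhds (hsU hw))).hasDerivAt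
  -- The derivative is a limit of difference quotients along a sequence tending to s; the
  -- denominator n + 2 keeps even its first point inside the open ball of radius r/2.
  have hmeas' : AEStronglyMeasurable (fun a => deriv (fun w => F w a) s) μ := by
    have hlim : Tendsto (fun n : ℕ => s + ((r / 2 / (n + 2) : ℝ) : ℂ)) atTop (𝓝[≠] s) := by
      rw [tendsto_nhdsWithin_iff]
      constructor
      · have h1 : Tendsto (fun n : ℕ => (r / 2 / (n + 2) : ℝ)) atTop (𝓝 0) :=
          Tendsto.div_atTop tendsto_const_nhds
            (tendsto_atTop_add_const_right _ _ tendsto_natCast_atTop_atTop)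
        have h2 := (Complex.continuous_ofReal.tendsto 0).comp h1
        simpa using h2.const_add s
      · refine Eventually.of_forall fun n => ?_
        have : (r / 2 / (n + 2) : ℝ) ≠ 0 := by positivity
        simpa [-Complex.ofReal_div] using this
    refine aestronglyMeasurable_of_tendsto_ae atTop
      (f := fun (n : ℕ) a => slope (fun w => F w a) s (s + ((r / 2 / (n + 2) : ℝ) : ℂ))) ?_ ?_
    · intro n
      have hmem : s + ((r / 2 / (n + 2) : ℝ) : ℂ) ∈ Metric.ball s (r / 2) := by
        rw [Metric.mem_ball, dist_eq_norm, add_sub_cancel_left, Complex.norm_real,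
          Real.norm_of_nonneg (by positivity)]
        rw [div_lt_iff₀ (by positivity)]
        have : (0 : ℝ) ≤ n := n.cast_nonneg
        nlinarith
      have h : AEStronglyMeasurable
          (fun a => F (s + ((r / 2 / (n + 2) : ℝ) : ℂ)) a - F s a) μ :=
        (hmeas _ (hsU hmem)).sub (hmeas _ hs)
      simp only [slope_def_field, div_eq_mul_inv]
      exact h.mul_const _
    · filter_upwards [hderiv] with a ha
      exact (hasDerivAt_iff_tendsto_slope.1 (ha s (Metric.mem_ball_self (by positivity)))).comp hlim
  refine (hasDerivAt_integral_of_dominated_loc_of_deriv_le (μ := μ)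
    (F := F) (F' := fun w a => deriv (fun w => F w a) w) (bound := fun a => g a / (r / 4))
    (Metric.ball_mem_nhds s (by positivity : 0 < r / 2)) ?_ ?_ hmeas' ?_ (hg.div_const _)
    hderiv).2.differentiableAt.differentiableWithinAt
  · filter_upwards [hU.mem_nhds hs] with w hw using hmeas w hw
  · refine hg.mono' (hmeas s hs) ?_
    filter_upwards [hb] with a ha using ha s hs
  · filter_upwards [hb, hd] with a ha hda w hw
    refine Complex.norm_deriv_le_of_forall_mem_sphere_norm_le (by positivity) ?_ ?_
    · refine (hda.mono ?_).diffContOnCl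
      rw [closure_ball _ (by positivity)]
      exact hball w hw
    · intro v hv
      exact ha v (hball w hw (Metric.sphere_subset_closedBall hv))

theorem one_add_pow_le_exp (n : ℕ) {ε : ℝ} (hε : 0 < ε) :
    ∃ C : ℝ, 0 < C ∧ ∀ v : ℝ, 0 ≤ v → (1 + v) ^ n ≤ C * Real.exp (ε * v) := by
  refine ⟨n ! / ε ^ n * Real.exp ε, by positivity, fun v hv => ?_⟩
  have h := Real.pow_div_factorial_le_exp (ε * (1 + v)) (by positivity) n
  rw [div_le_iff₀ (by positivity), mul_pow, mul_add, Real.exp_add, mul_one] at h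
  have h2 : (1 + v) ^ n = ε ^ n * (1 + v) ^ n / ε ^ n := by field_simp
  rw [h2, div_le_iff₀ (by positivity)]
  calc _ ≤ _ := h
    _ = _ := by field_simp

theorem integrableOn_one_add_pow_mul_exp (n : ℕ) {x : ℝ} (hx : 0 < x) :
    IntegrableOn (fun v : ℝ => (1 + v) ^ n * Real.exp (-(x * v))) (Ioi 0) := by
  obtain ⟨C, hC, h⟩ := one_add_pow_le_exp n (half_pos hx)
  have hI : IntegrableOn (fun v : ℝ => C * Real.exp (-(x / 2) * v)) (Ioi 0) :=
    (exp_neg_integrableOn_Ioi 0 (half_pos hx)).const_mul C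
  refine hI.mono' (by fun_prop) ?_
  refine (ae_restrict_mem measurableSet_Ioi).mono fun v hv => ?_
  have hv : (0 : ℝ) < v := hv
  rw [Real.norm_of_nonneg (by positivity)]
  calc _ ≤ C * Real.exp (x / 2 * v) * Real.exp (-(x * v)) := by gcongr; exact h v hv.le
    _ = C * Real.exp (-(x / 2) * v) := by
      rw [mul_assoc, ← Real.exp_add]; ring_nf

/-- The integral of `v ^ (a - 1) * exp (-r v)` over the positive reals, for complex `r`. -/
theorem integral_cpow_mul_exp_neg_complex_mul_Ioi {a r : ℂ} (ha : 0 < a.re) (hr : 0 < r.re) :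
    ∫ t : ℝ in Ioi 0, (t : ℂ) ^ (a - 1) * Complex.exp (-(r * t))
      = (1 / r) ^ a * Complex.Gamma a := by
  have hopen : IsOpen {r : ℂ | 0 < r.re} := isOpen_lt continuous_const Complex.continuous_re
  have hconn : IsPreconnected {r : ℂ | 0 < r.re} := (convex_halfSpace_re_gt 0).isPreconnected
  have hmeas : ∀ s : ℂ, AEStronglyMeasurable
      (fun t : ℝ => (t : ℂ) ^ (a - 1) * Complex.exp (-(s * t))) (volume.restrict (Ioi 0)) := by
    intro s
    refine ContinuousOn.aestronglyMeasurable (fun t ht => ?_) measurableSet_Ioi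
    exact ((Complex.continuousAt_ofReal_cpow_const _ _ (Or.inr (ne_of_gt ht))).mul
      (by fun_prop)).continuousWithinAt
  have hL : DifferentiableOn ℂ (fun r : ℂ => ∫ t : ℝ in Ioi 0,
      (t : ℂ) ^ (a - 1) * Complex.exp (-(r * t))) {r : ℂ | 0 < r.re} := by
    intro r₀ hr₀
    have hr₀ : 0 < r₀.re := hr₀
    have hU : IsOpen {r : ℂ | r₀.re / 2 < r.re} :=
      isOpen_lt continuous_const Complex.continuous_re
    have hmem : r₀ ∈ {r : ℂ | r₀.re / 2 < r.re} := by simp only [mem_ofPred_eq]; linarith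
    have hint : IntegrableOn (fun t : ℝ => t ^ (a.re - 1) * Real.exp (-(r₀.re / 2) * t)) (Ioi 0) := by
      have := integrableOn_rpow_mul_exp_neg_mul_rpow (s := a.re - 1) (p := 1)
        (b := r₀.re / 2) (by linarith) one_pos (by linarith)
      simpa using this
    refine ((differentiableOn_integral_of_dominated hU hint (fun s _ => hmeas s) ?_ ?_).differentiableAt
      (hU.mem_nhds hmem)).differentiableWithinAt
    · exact Eventually.of_forall fun t => by fun_prop
    · refine (ae_restrict_mem measurableSet_Ioi).mono fun t ht s hs => ?_
      have ht : 0 < t := ht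
      rw [norm_mul, Complex.norm_cpow_eq_rpow_re_of_pos ht, Complex.norm_exp]
      have hs : r₀.re / 2 < s.re := hs
      simp only [Complex.sub_re, Complex.one_re, Complex.neg_re, Complex.mul_re,
        Complex.ofReal_re, Complex.ofReal_im, mul_zero, sub_zero]
      gcongr
      nlinarith
  have hR : DifferentiableOn ℂ (fun r : ℂ => (1 / r) ^ a * Complex.Gamma a) {r : ℂ | 0 < r.re} := by
    intro r hr
    have hr : 0 < r.re := hr
    have hr0 : r ≠ 0 := by rintro rfl; simp at hr
    have : (1 / r) ∈ Complex.slitPlane := by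
      left
      rw [one_div, Complex.inv_re]
      have := Complex.normSq_pos.2 hr0
      positivity
    refine DifferentiableAt.differentiableWithinAt ?_
    refine DifferentiableAt.mul_const ?_ _
    exact DifferentiableAt.cpow_const ((differentiableAt_const _).div differentiableAt_id hr0) this
  have h1 : (1 : ℂ) ∈ {r : ℂ | 0 < r.re} := by simp
  -- Both sides are holomorphic in the right half plane and agree at the real points 1 + 1/(n+1),
  -- which accumulate at 1.
  refine (hL.analyticOnNhd hopen).eqOn_of_preconnected_of_frequently_eq (hR.analyticOnNhd hopen)
    hconn h1 ?_ hr
  have hlim : Tendsto (fun n : ℕ => ((1 + 1 / ((n : ℝ) + 1) : ℝ) : ℂ)) atTop (𝓝[≠] 1) := by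
    rw [tendsto_nhdsWithin_iff]
    constructor
    · have h2 := (Complex.continuous_ofReal.tendsto 0).comp
        (tendsto_one_div_add_atTop_nhds_zero_nat (𝕜 := ℝ))
      simpa using h2.const_add 1
    · refine Eventually.of_forall fun n => ?_
      have : (1 / ((n : ℝ) + 1) : ℝ) ≠ 0 := by positivity
      have h3 : (1 + 1 / ((n : ℝ) + 1) : ℝ) ≠ 1 := by simpa using this
      simpa only [mem_compl_iff, mem_singleton_iff, Complex.ofReal_eq_one] using h3
  refine hlim.frequently (Eventually.frequently (Eventually.of_forall fun n => ?_))
  exact Complex.integral_cpow_mul_exp_neg_mul_Ioi ha (by positivity)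

end NonholoEisenstein

/-! ### Tricomi's function: integral, continuation, recurrences. -/

namespace NonholoEisenstein
open MeasureTheory Set Filter Topology

noncomputable section

/-- The integral `∫_0^∞ v ^ (a - 1) (1 + v) ^ c e ^ (-x v) dv`. -/
def tricomiIntegral (a c : ℂ) (x : ℝ) : ℂ :=
  ∫ v : ℝ in Ioi 0, (v : ℂ) ^ (a - 1) * ((1 + v : ℝ) : ℂ) ^ c * Complex.exp (-(x * v))

/-- The continuation of `Γ(a)⁻¹ ∫_0^∞ v ^ (a - 1) (1 + v) ^ c e ^ (-x v) dv` to `Re a > -n`. -/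
def tricomiAux : ℕ → ℂ → ℂ → ℝ → ℂ
  | 0, a, c, x => (Complex.Gamma a)⁻¹ * tricomiIntegral a c x
  | n + 1, a, c, x => x * tricomiAux n (a + 1) c x - c * tricomiAux n (a + 1) (c - 1) x

/-- The entire continuation in `a` and `c` of `Γ(a)⁻¹ ∫_0^∞ v ^ (a - 1) (1 + v) ^ c e ^ (-x v) dv`:
Tricomi's confluent hypergeometric function `U(a, a + c + 1, x)`. -/
def tricomi (a c : ℂ) (x : ℝ) : ℂ := tricomiAux (⌊|a.re|⌋₊ + 1) a c x

end

theorem continuousOn_tricomi_integrand (a c : ℂ) (x : ℝ) :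
    ContinuousOn (fun v : ℝ => (v : ℂ) ^ (a - 1) * ((1 + v : ℝ) : ℂ) ^ c *
      Complex.exp (-(x * v))) (Ioi 0) := by
  intro v hv
  have hv : 0 < v := hv
  refine ContinuousAt.continuousWithinAt ?_
  refine ((Complex.continuousAt_ofReal_cpow_const _ _ (Or.inr hv.ne')).mul ?_).mul (by fun_prop)
  exact (Complex.continuousAt_ofReal_cpow_const (1 + v) c (Or.inr (by positivity))).comp
    (f := fun v : ℝ => 1 + v) (by fun_prop)

theorem norm_tricomi_integrand (a c : ℂ) (x : ℝ) {v : ℝ} (hv : 0 < v) :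
    ‖(v : ℂ) ^ (a - 1) * ((1 + v : ℝ) : ℂ) ^ c * Complex.exp (-(x * v))‖
      = v ^ (a.re - 1) * (1 + v) ^ c.re * Real.exp (-(x * v)) := by
  rw [norm_mul, norm_mul, Complex.norm_cpow_eq_rpow_re_of_pos hv,
    Complex.norm_cpow_eq_rpow_re_of_pos (by positivity), Complex.norm_exp]
  simp

theorem integrableOn_tricomi_integrand {a : ℂ} (c : ℂ) {x : ℝ} (ha : 0 < a.re) (hx : 0 < x) :
    IntegrableOn (fun v : ℝ => (v : ℂ) ^ (a - 1) * ((1 + v : ℝ) : ℂ) ^ c *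
      Complex.exp (-(x * v))) (Ioi 0) := by
  obtain ⟨n, hn⟩ := exists_nat_ge c.re
  obtain ⟨C, hC, h⟩ := one_add_pow_le_exp n (half_pos hx)
  have hint : IntegrableOn (fun t : ℝ => C * (t ^ (a.re - 1) * Real.exp (-(x / 2) * t)))
      (Ioi 0) := by
    have := integrableOn_rpow_mul_exp_neg_mul_rpow (s := a.re - 1) (p := 1)
      (b := x / 2) (by linarith) one_pos (by linarith)
    simp only [Real.rpow_one] at this
    exact this.const_mul C
  refine hint.mono' ((continuousOn_tricomi_integrand a c x).aestronglyMeasurable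
    measurableSet_Ioi) ?_
  refine (ae_restrict_mem measurableSet_Ioi).mono fun v hv => ?_
  have hv : 0 < v := hv
  rw [norm_tricomi_integrand a c x hv]
  have h1 : (1 + v) ^ c.re ≤ (1 + v) ^ n := by
    rw [← Real.rpow_natCast]
    exact Real.rpow_le_rpow_of_exponent_le (by linarith) hn
  calc _ ≤ v ^ (a.re - 1) * (C * Real.exp (x / 2 * v)) * Real.exp (-(x * v)) := by
        gcongr; exact h1.trans (h v hv.le)
    _ = C * (v ^ (a.re - 1) * (Real.exp (x / 2 * v) * Real.exp (-(x * v)))) := by ring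
    _ = _ := by rw [← Real.exp_add]; ring_nf

/-- For Re a ≥ 1 there is no singularity at v = 0, so one majorant serves all a, c in a bounded set
and all x ≥ x₀. -/
theorem norm_tricomi_integrand_le {a c : ℂ} {x₀ x v : ℝ} {N : ℕ} (ha : 1 ≤ a.re)
    (hN : a.re - 1 + |c.re| ≤ N) (hx : x₀ ≤ x) (hv : 0 < v) :
    ‖(v : ℂ) ^ (a - 1) * ((1 + v : ℝ) : ℂ) ^ c * Complex.exp (-(x * v))‖
      ≤ (1 + v) ^ N * Real.exp (-(x₀ * v)) := by
  rw [norm_tricomi_integrand a c x hv]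
  have h1 : v ^ (a.re - 1) ≤ (1 + v) ^ (a.re - 1) :=
    Real.rpow_le_rpow hv.le (by linarith) (by linarith)
  have h2 : (1 + v) ^ c.re ≤ (1 + v) ^ |c.re| :=
    Real.rpow_le_rpow_of_exponent_le (by linarith) (le_abs_self _)
  have h3 : (1 + v) ^ (a.re - 1) * (1 + v) ^ |c.re| ≤ (1 + v) ^ N := by
    rw [← Real.rpow_add (by linarith), ← Real.rpow_natCast]
    exact Real.rpow_le_rpow_of_exponent_le (by linarith) hN
  calc _ ≤ ((1 + v) ^ (a.re - 1) * (1 + v) ^ |c.re|) * Real.exp (-(x₀ * v)) := by gcongr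
    _ ≤ _ := by gcongr

theorem tendsto_tricomi_boundary (a c : ℂ) {x : ℝ} (hx : 0 < x) :
    Tendsto (fun v : ℝ => (v : ℂ) ^ a * ((1 + v : ℝ) : ℂ) ^ c * Complex.exp (-(x * v)))
      atTop (𝓝 0) := by
  obtain ⟨n, hn⟩ := exists_nat_ge (|a.re| + |c.re|)
  obtain ⟨C, hC, h⟩ := one_add_pow_le_exp n (half_pos hx)
  have hlim : Tendsto (fun v : ℝ => C * Real.exp (-(x / 2 * v))) atTop (𝓝 0) := by
    have : Tendsto (fun v : ℝ => Real.exp (-(x / 2 * v))) atTop (𝓝 0) :=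
      Real.tendsto_exp_neg_atTop_nhds_zero.comp
        (tendsto_id.const_mul_atTop (half_pos hx))
    simpa using this.const_mul C
  refine squeeze_zero_norm' ?_ hlim
  filter_upwards [eventually_ge_atTop 1] with v hv
  have hv0 : 0 < v := by linarith
  have h0 := norm_tricomi_integrand (a + 1) c x hv0
  simp only [add_sub_cancel_right, Complex.add_re, Complex.one_re] at h0
  rw [h0]
  have h1 : v ^ a.re ≤ (1 + v) ^ |a.re| :=
    (Real.rpow_le_rpow_of_exponent_le hv (le_abs_self _)).trans
      (Real.rpow_le_rpow hv0.le (by linarith) (abs_nonneg _))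
  have h2 : (1 + v) ^ c.re ≤ (1 + v) ^ |c.re| :=
    Real.rpow_le_rpow_of_exponent_le (by linarith) (le_abs_self _)
  have h3 : (1 + v) ^ |a.re| * (1 + v) ^ |c.re| ≤ (1 + v) ^ n := by
    rw [← Real.rpow_add (by linarith), ← Real.rpow_natCast]
    exact Real.rpow_le_rpow_of_exponent_le (by linarith) hn
  calc _ ≤ ((1 + v) ^ |a.re| * (1 + v) ^ |c.re|) * Real.exp (-(x * v)) := by gcongr
    _ ≤ (C * Real.exp (x / 2 * v)) * Real.exp (-(x * v)) :=
        mul_le_mul_of_nonneg_right (h3.trans (h v hv0.le)) (Real.exp_pos _).le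
    _ = _ := by rw [mul_assoc, ← Real.exp_add]; ring_nf

theorem hasDerivAt_tricomi_boundary (a c : ℂ) (x : ℝ) {v : ℝ} (hv : 0 < v) :
    HasDerivAt (fun v : ℝ => (v : ℂ) ^ a * ((1 + v : ℝ) : ℂ) ^ c * Complex.exp (-(x * v)))
      (a * ((v : ℂ) ^ (a - 1) * ((1 + v : ℝ) : ℂ) ^ c * Complex.exp (-(x * v)))
        + c * ((v : ℂ) ^ a * ((1 + v : ℝ) : ℂ) ^ (c - 1) * Complex.exp (-(x * v)))
        - x * ((v : ℂ) ^ a * ((1 + v : ℝ) : ℂ) ^ c * Complex.exp (-(x * v)))) v := by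
  have h1 : HasDerivAt (fun v : ℝ => (v : ℂ) ^ a) (a * (v : ℂ) ^ (a - 1) * 1) v :=
    HasDerivAt.comp_ofReal (e := fun z : ℂ => z ^ a)
      ((hasDerivAt_id (v : ℂ)).cpow_const (by left; simpa using hv))
  have h2 : HasDerivAt (fun v : ℝ => ((1 + v : ℝ) : ℂ) ^ c)
      (c * ((1 + v : ℝ) : ℂ) ^ (c - 1) * 1) v := by
    have := HasDerivAt.comp_ofReal (z := v) (e := fun z : ℂ => (1 + z) ^ c)
      (((hasDerivAt_id (v : ℂ)).const_add 1).cpow_const (c := c) (by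
        left
        simp
        linarith))
    simpa using this
  have h3 : HasDerivAt (fun v : ℝ => Complex.exp (-(x * v)))
      (Complex.exp (-(x * v)) * (-(x * 1))) v :=
    HasDerivAt.comp_ofReal (e := fun z : ℂ => Complex.exp (-(x * z)))
      (((hasDerivAt_id (v : ℂ)).const_mul (x : ℂ)).neg.cexp)
  refine ((h1.mul h2).mul h3).congr_deriv ?_
  simp only [Pi.mul_apply]
  ring

/-- Integrate the derivative of v^a (1+v)^c e^(-xv) over the half line; both boundary values vanish.
-/
theorem tricomiIntegral_recurrence {a : ℂ} (c : ℂ) {x : ℝ} (ha : 0 < a.re) (hx : 0 < x) :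
    a * tricomiIntegral a c x
      = x * tricomiIntegral (a + 1) c x - c * tricomiIntegral (a + 1) (c - 1) x := by
  have ha1 : 0 < (a + 1).re := by simp; linarith
  have i1 := (integrableOn_tricomi_integrand c ha hx).const_mul a
  have i2 := (integrableOn_tricomi_integrand (c - 1) ha1 hx).const_mul c
  have i3 := (integrableOn_tricomi_integrand c ha1 hx).const_mul x
  simp only [add_sub_cancel_right] at i2 i3
  have i12 := i1.add i2
  simp only [Pi.add_def] at i12
  have ha0 : a ≠ 0 := by rintro rfl; simp at ha
  have key := integral_Ioi_of_hasDerivAt_of_tendsto (a := 0) (m := 0)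
    (f := fun v : ℝ => (v : ℂ) ^ a * ((1 + v : ℝ) : ℂ) ^ c * Complex.exp (-(x * v))) ?_
    (fun v hv => hasDerivAt_tricomi_boundary a c x hv) (i12.sub i3)
    (tendsto_tricomi_boundary a c hx)
  · rw [integral_sub i12 i3, integral_add i1 i2, integral_const_mul, integral_const_mul,
      integral_const_mul] at key
    simp only [Complex.ofReal_zero, Complex.zero_cpow ha0, zero_mul, sub_zero] at key
    simp only [tricomiIntegral, add_sub_cancel_right]
    linear_combination key
  · refine ContinuousAt.continuousWithinAt ?_
    refine ((Complex.continuousAt_ofReal_cpow_const _ _ (Or.inl ha)).mul ?_).mul (by fun_prop)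
    exact (Complex.continuousAt_ofReal_cpow_const (1 + 0) c (Or.inr (by norm_num))).comp
      (f := fun v : ℝ => 1 + v) (by fun_prop)

/-- The same integration by parts with a = 0: the boundary value at 0 is now 1, which is what makes
`tricomi 0 c x` equal to 1. -/
theorem tricomiIntegral_recurrence_zero (c : ℂ) {x : ℝ} (hx : 0 < x) :
    x * tricomiIntegral 1 c x - c * tricomiIntegral 1 (c - 1) x = 1 := by
  have i2 := (integrableOn_tricomi_integrand (a := 1) (c - 1) (by simp) hx).const_mul c
  have i3 := (integrableOn_tricomi_integrand (a := 1) c (by simp) hx).const_mul x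
  simp only [sub_self] at i2 i3
  have key := integral_Ioi_of_hasDerivAt_of_tendsto (a := 0) (m := 0)
    (f := fun v : ℝ => (v : ℂ) ^ (0 : ℂ) * ((1 + v : ℝ) : ℂ) ^ c * Complex.exp (-(x * v))) ?_
    (f' := fun v : ℝ => c * ((v : ℂ) ^ (0 : ℂ) * ((1 + v : ℝ) : ℂ) ^ (c - 1) *
        Complex.exp (-(x * v)))
        - x * ((v : ℂ) ^ (0 : ℂ) * ((1 + v : ℝ) : ℂ) ^ c * Complex.exp (-(x * v))))
    (fun v hv => (hasDerivAt_tricomi_boundary 0 c x hv).congr_deriv (by ring)) (i2.sub i3)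
    (tendsto_tricomi_boundary 0 c hx)
  · rw [integral_sub i2 i3, integral_const_mul, integral_const_mul] at key
    simp only [tricomiIntegral, sub_self]
    simp only [Complex.ofReal_zero, Complex.cpow_zero, add_zero, Complex.ofReal_one,
      Complex.one_cpow, mul_zero, neg_zero, Complex.exp_zero, mul_one] at key ⊢
    linear_combination -key
  · refine ContinuousAt.continuousWithinAt ?_
    simp only [Complex.cpow_zero]
    refine (continuousAt_const.mul ?_).mul (by fun_prop)
    exact (Complex.continuousAt_ofReal_cpow_const (1 + 0) c (Or.inr (by norm_num))).comp
      (f := fun v : ℝ => 1 + v) (by fun_prop)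

/-- Consistency of the continuation. The base case is integration by parts combined with Γ(a+1) = a
Γ(a). -/
theorem tricomiAux_succ (n : ℕ) {a : ℂ} (c : ℂ) {x : ℝ} (ha : -n < a.re) (hx : 0 < x) :
    tricomiAux (n + 1) a c x = tricomiAux n a c x := by
  induction n generalizing a c with
  | zero =>
    have ha : 0 < a.re := by simpa using ha
    have ha0 : a ≠ 0 := by rintro rfl; simp at ha
    have hG : Complex.Gamma a ≠ 0 := Complex.Gamma_ne_zero_of_re_pos ha
    simp only [tricomiAux]
    rw [Complex.Gamma_add_one a ha0]
    field_simp
    linear_combination -tricomiIntegral_recurrence c ha hx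
  | succ n ih =>
    have h : -n < (a + 1).re := by push_cast at ha; simp; linarith
    rw [tricomiAux, ih c h, ih (c - 1) h]
    rfl

theorem tricomiAux_eq_of_le {m n : ℕ} (hmn : m ≤ n) {a : ℂ} (c : ℂ) {x : ℝ} (ha : -m < a.re)
    (hx : 0 < x) : tricomiAux n a c x = tricomiAux m a c x := by
  induction n, hmn using Nat.le_induction with
  | base => rfl
  | succ n hn ih =>
    rw [tricomiAux_succ n c _ hx, ih]
    have : (m : ℝ) ≤ n := by exact_mod_cast hn
    linarith

theorem tricomi_eq_tricomiAux {n : ℕ} {a : ℂ} (c : ℂ) {x : ℝ} (ha : -n < a.re) (hx : 0 < x) :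
    tricomi a c x = tricomiAux n a c x := by
  have h : -((⌊|a.re|⌋₊ + 1 : ℕ) : ℝ) < a.re := by
    have := Nat.lt_floor_add_one |a.re|
    push_cast
    linarith [neg_abs_le a.re]
  rcases le_total n (⌊|a.re|⌋₊ + 1) with hle | hle
  · exact tricomiAux_eq_of_le hle c ha hx
  · exact (tricomiAux_eq_of_le hle c h hx).symm

theorem tricomi_of_re_pos {a : ℂ} (c : ℂ) {x : ℝ} (ha : 0 < a.re) (hx : 0 < x) :
    tricomi a c x = (Complex.Gamma a)⁻¹ * tricomiIntegral a c x :=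
  tricomi_eq_tricomiAux (n := 0) c (by simpa using ha) hx

theorem tricomi_recurrence (a c : ℂ) {x : ℝ} (hx : 0 < x) :
    tricomi a c x = x * tricomi (a + 1) c x - c * tricomi (a + 1) (c - 1) x := by
  obtain ⟨n, hn⟩ := exists_nat_gt (-a.re)
  have h1 : -(n : ℝ) < (a + 1).re := by simp; linarith
  have h2 : -((n + 1 : ℕ) : ℝ) < a.re := by push_cast; linarith
  rw [tricomi_eq_tricomiAux c h1 hx, tricomi_eq_tricomiAux (c - 1) h1 hx,
    tricomi_eq_tricomiAux c h2 hx]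
  rfl

theorem tricomi_zero_left (c : ℂ) {x : ℝ} (hx : 0 < x) : tricomi 0 c x = 1 := by
  rw [tricomi_recurrence 0 c hx, zero_add, tricomi_of_re_pos c (by simp) hx,
    tricomi_of_re_pos (c - 1) (by simp) hx, Complex.Gamma_one, inv_one, one_mul, one_mul,
    tricomiIntegral_recurrence_zero c hx]

end NonholoEisenstein

/-! ### Tricomi's function: growth, holomorphy, terminating expansions. -/

namespace NonholoEisenstein
open MeasureTheory Set Filter Topology

/-- The range 1 - n ≤ Re a stays one unit inside the domain of validity, so that n = 0 means Re a ≥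
1, where a uniform majorant exists. Each recurrence step costs one power of x and enlarges R by one.
-/
theorem exists_norm_tricomiAux_le (n : ℕ) : ∀ (R : ℝ) {x₀ : ℝ}, 0 < x₀ → ∃ C : ℝ, 0 < C ∧
    ∀ (a c : ℂ) (x : ℝ), ‖a‖ ≤ R → ‖c‖ ≤ R → 1 - n ≤ a.re → x₀ ≤ x →
      ‖tricomiAux n a c x‖ ≤ C * (1 + x) ^ n := by
  induction n with
  | zero =>
    intro R x₀ hx₀
    obtain ⟨B, hB⟩ := (isCompact_closedBall (0 : ℂ) R).exists_bound_of_continuousOn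
      Complex.differentiable_one_div_Gamma.continuous.continuousOn
    obtain ⟨N, hN⟩ := exists_nat_ge (2 * R)
    have hI := integrableOn_one_add_pow_mul_exp N hx₀
    set I := ∫ v : ℝ in Ioi 0, (1 + v) ^ N * Real.exp (-(x₀ * v)) with hIdef
    have hI0 : 0 ≤ I := setIntegral_nonneg measurableSet_Ioi fun v hv => by
      have hv : (0 : ℝ) < v := hv
      positivity
    refine ⟨(|B| + 1) * (I + 1), by positivity, fun a c x ha hc hre hx => ?_⟩
    have hre : 1 ≤ a.re := by simpa using hre
    have h1 : ‖tricomiIntegral a c x‖ ≤ I := by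
      refine norm_integral_le_of_norm_le hI ?_
      refine (ae_restrict_mem measurableSet_Ioi).mono fun v hv => ?_
      refine norm_tricomi_integrand_le hre ?_ hx hv
      have := Complex.re_le_norm a
      have := Complex.abs_re_le_norm c
      linarith
    have h2 : ‖(Complex.Gamma a)⁻¹‖ ≤ |B| := (hB a (by simpa using ha)).trans (le_abs_self _)
    rw [tricomiAux, norm_mul, pow_zero, mul_one]
    gcongr
    · linarith
    · linarith
  | succ n ih =>
    intro R x₀ hx₀
    obtain ⟨C, hC, h⟩ := ih (R + 1) hx₀
    refine ⟨C * (1 + |R|), by positivity, fun a c x ha hc hre hx => ?_⟩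
    have hx0 : 0 < x := by linarith
    have ha1 : ‖a + 1‖ ≤ R + 1 := (norm_add_le _ _).trans (by simpa using ha)
    have hc1 : ‖c - 1‖ ≤ R + 1 := (norm_sub_le _ _).trans (by simpa using hc)
    have hre1 : 1 - (n : ℝ) ≤ (a + 1).re := by push_cast at hre; simp; linarith
    have h1 := h (a + 1) c x ha1 (by linarith) hre1 hx
    have h2 := h (a + 1) (c - 1) x ha1 hc1 hre1 hx
    rw [tricomiAux]
    have hcR : ‖c‖ ≤ |R| := hc.trans (le_abs_self _)
    calc _ ≤ ‖(x : ℂ)‖ * ‖tricomiAux n (a + 1) c x‖ + ‖c‖ * ‖tricomiAux n (a + 1) (c - 1) x‖ := by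
          refine (norm_sub_le _ _).trans ?_
          rw [norm_mul, norm_mul]
      _ ≤ x * (C * (1 + x) ^ n) + |R| * (C * (1 + x) ^ n) := by
          rw [Complex.norm_real, Real.norm_of_nonneg hx0.le]
          gcongr
      _ ≤ C * (1 + |R|) * (1 + x) ^ (n + 1) := by
          have : x + |R| ≤ (1 + |R|) * (1 + x) := by nlinarith [abs_nonneg R]
          calc _ = C * (1 + x) ^ n * (x + |R|) := by ring
            _ ≤ C * (1 + x) ^ n * ((1 + |R|) * (1 + x)) := by gcongr
            _ = _ := by ring

/-- For `a` and `c` in a bounded set, `tricomi a c x` grows at most polynomially in `x`. -/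
theorem exists_norm_tricomi_le (R : ℝ) {x₀ : ℝ} (hx₀ : 0 < x₀) : ∃ (C : ℝ) (n : ℕ), 0 < C ∧
    ∀ (a c : ℂ) (x : ℝ), ‖a‖ ≤ R → ‖c‖ ≤ R → x₀ ≤ x → ‖tricomi a c x‖ ≤ C * (1 + x) ^ n := by
  obtain ⟨n, hn⟩ := exists_nat_ge (R + 1)
  obtain ⟨C, hC, h⟩ := exists_norm_tricomiAux_le n R hx₀
  refine ⟨C, n, hC, fun a c x ha hc hx => ?_⟩
  have h1 := neg_abs_le a.re
  have h2 := Complex.abs_re_le_norm a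
  rw [tricomi_eq_tricomiAux (n := n) c (by linarith) (by linarith)]
  exact h a c x ha hc (by linarith) hx

theorem differentiableOn_tricomiAux (n : ℕ) (a c : ℂ) {x : ℝ} (hx : 0 < x) :
    DifferentiableOn ℂ (fun s => tricomiAux n (s + a) (s + c) x) {s | 1 - n < (s + a).re} := by
  induction n generalizing a c with
  | zero =>
    intro s₀ hs₀
    obtain ⟨N, hN⟩ := exists_nat_ge (‖s₀‖ + 1 + ‖a‖ + (‖s₀‖ + 1 + ‖c‖))
    have hU : IsOpen ({s | 1 - ((0 : ℕ) : ℝ) < (s + a).re} ∩ Metric.ball s₀ 1) :=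
      (isOpen_lt continuous_const (by fun_prop)).inter Metric.isOpen_ball
    refine DifferentiableAt.differentiableWithinAt ?_
    refine DifferentiableAt.mul ?_ ?_
    · exact DifferentiableAt.comp (g := fun s => (Complex.Gamma s)⁻¹) s₀
        (Complex.differentiable_one_div_Gamma _) (by fun_prop)
    · refine (differentiableOn_integral_of_dominated hU (integrableOn_one_add_pow_mul_exp N hx)
        ?_ ?_ ?_).differentiableAt (hU.mem_nhds ⟨hs₀, Metric.mem_ball_self one_pos⟩)
      · intro s _
        exact (continuousOn_tricomi_integrand _ _ x).aestronglyMeasurable measurableSet_Ioi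
      · refine (ae_restrict_mem measurableSet_Ioi).mono fun v hv => ?_
        have hv : (0 : ℝ) < v := hv
        have hv1 : (v : ℂ) ≠ 0 := by exact_mod_cast hv.ne'
        have hv2 : ((1 + v : ℝ) : ℂ) ≠ 0 := by exact_mod_cast (by positivity : (1 + v) ≠ 0)
        refine Differentiable.differentiableOn ?_
        refine (Differentiable.mul ?_ ?_).mul_const _
        · exact Differentiable.const_cpow (by fun_prop) (Or.inl hv1)
        · exact Differentiable.const_cpow (by fun_prop) (Or.inl hv2)
      · refine (ae_restrict_mem measurableSet_Ioi).mono fun v hv s hs => ?_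
        have h1 : 1 < (s + a).re := by simpa using hs.1
        refine norm_tricomi_integrand_le h1.le ?_ le_rfl hv
        have h2 : ‖s‖ ≤ ‖s₀‖ + 1 := by
          have h3 := hs.2
          rw [Metric.mem_ball, dist_eq_norm] at h3
          linarith [norm_le_norm_add_norm_sub' s s₀]
        have h4 := Complex.re_le_norm (s + a)
        have h5 := Complex.abs_re_le_norm (s + c)
        have h6 := norm_add_le s a
        have h7 := norm_add_le s c
        linarith
  | succ n ih =>
    simp only [tricomiAux]
    have hset : {s : ℂ | 1 - ((n + 1 : ℕ) : ℝ) < (s + a).re}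
        = {s : ℂ | 1 - (n : ℝ) < (s + (a + 1)).re} := by
      ext s
      simp only [mem_ofPred_eq, Complex.add_re, Complex.one_re]
      push_cast
      constructor <;> intro h <;> linarith
    rw [hset]
    have h1 := ih (a + 1) c
    have h2 := ih (a + 1) (c - 1)
    simp only [← add_assoc, ← add_sub_assoc] at h1 h2 ⊢
    exact (h1.const_mul _).sub (DifferentiableOn.mul (by fun_prop) h2)

/-- The number of recurrence steps in `tricomi` jumps with Re a, so near each point it is replaced
by a fixed n. -/
theorem differentiable_tricomi (a c : ℂ) {x : ℝ} (hx : 0 < x) :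
    Differentiable ℂ (fun s => tricomi (s + a) (s + c) x) := by
  intro s₀
  obtain ⟨n, hn⟩ := exists_nat_gt (1 - (s₀ + a).re)
  have hU : IsOpen {s : ℂ | 1 - (n : ℝ) < (s + a).re} := isOpen_lt continuous_const (by fun_prop)
  have hmem : {s : ℂ | 1 - (n : ℝ) < (s + a).re} ∈ 𝓝 s₀ :=
    hU.mem_nhds (by simp only [mem_ofPred_eq]; linarith)
  refine ((differentiableOn_tricomiAux n a c hx).differentiableAt hmem).congr_of_eventuallyEq ?_
  filter_upwards [hmem] with s hs
  have hs : 1 - (n : ℝ) < (s + a).re := hs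
  exact tricomi_eq_tricomiAux _ (by linarith) hx

/-- From (1+v)^(c+1) = (1+v)^c + v (1+v)^c. -/
theorem tricomiIntegral_add_one {a : ℂ} (c : ℂ) {x : ℝ} (ha : 0 < a.re) (hx : 0 < x) :
    tricomiIntegral a (c + 1) x = tricomiIntegral a c x + tricomiIntegral (a + 1) c x := by
  have ha1 : 0 < (a + 1).re := by simp; linarith
  have ha0 : a ≠ 0 := by rintro rfl; simp at ha
  simp only [tricomiIntegral]
  rw [← integral_add (integrableOn_tricomi_integrand c ha hx)
    (integrableOn_tricomi_integrand c ha1 hx)]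
  refine setIntegral_congr_fun measurableSet_Ioi fun v hv => ?_
  have hv : (0 : ℝ) < v := hv
  have hv1 : (v : ℂ) ≠ 0 := by exact_mod_cast hv.ne'
  have hv2 : ((1 + v : ℝ) : ℂ) ≠ 0 := by exact_mod_cast (by positivity : (1 + v) ≠ 0)
  rw [Complex.cpow_add _ _ hv2, add_sub_cancel_right, Complex.cpow_one,
    Complex.cpow_sub _ _ hv1, Complex.cpow_one]
  field_simp
  push_cast
  ring

theorem tricomi_add_one {a : ℂ} (c : ℂ) {x : ℝ} (ha : 0 < a.re) (hx : 0 < x) :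
    tricomi a (c + 1) x = tricomi a c x + a * tricomi (a + 1) c x := by
  have ha0 : a ≠ 0 := by rintro rfl; simp at ha
  have ha1 : 0 < (a + 1).re := by simp; linarith
  have hG : Complex.Gamma a ≠ 0 := Complex.Gamma_ne_zero_of_re_pos ha
  rw [tricomi_of_re_pos _ ha hx, tricomi_of_re_pos _ ha hx, tricomi_of_re_pos _ ha1 hx,
    tricomiIntegral_add_one c ha hx, Complex.Gamma_add_one a ha0]
  field_simp

theorem tricomi_zero_right {a : ℂ} {x : ℝ} (ha : 0 < a.re) (hx : 0 < x) :
    tricomi a 0 x = (x : ℂ) ^ (-a) := by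
  have hG : Complex.Gamma a ≠ 0 := Complex.Gamma_ne_zero_of_re_pos ha
  rw [tricomi_of_re_pos _ ha hx, tricomiIntegral]
  simp only [Complex.cpow_zero, mul_one]
  rw [integral_cpow_mul_exp_neg_complex_mul_Ioi ha (by simpa using hx), one_div,
    Complex.inv_cpow _ _ (by rw [Complex.arg_ofReal_of_nonneg hx.le]; exact Real.pi_pos.ne),
    Complex.cpow_neg]
  field_simp

noncomputable section

/-- The first `J` terms of the asymptotic expansion of `tricomi a c x` for integers `a` and `c`. -/
def tricomiSum (a c : ℤ) (J : ℕ) (x : ℝ) : ℂ :=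
  ∑ j ∈ Finset.range J, ((Ring.choose c j : ℤ) : ℂ) * (ascPochhammer ℂ j).eval (a : ℂ) *
    (x : ℂ) ^ (-a - j)

end

theorem succ_mul_ringChoose (c : ℤ) (j : ℕ) :
    ((j : ℤ) + 1) * Ring.choose c (j + 1) = c * Ring.choose (c - 1) j := by
  have h1 := Ring.descPochhammer_eq_factorial_smul_choose c (j + 1)
  have h2 := Ring.descPochhammer_eq_factorial_smul_choose (c - 1) j
  rw [descPochhammer_succ_left, Polynomial.smeval_X_mul] at h1
  have h3 : ((j ! : ℕ) : ℤ) ≠ 0 := by positivity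
  apply mul_left_cancel₀ h3
  rw [Polynomial.smeval_comp] at h1
  simp only [Polynomial.smeval_sub, Polynomial.smeval_X, Polynomial.smeval_one, pow_one, pow_zero,
    nsmul_eq_mul, one_smul, Nat.factorial_succ] at h1 h2
  rw [h2] at h1
  push_cast at h1
  linear_combination -h1

/-- The finite-sum counterpart of `tricomi_recurrence`, term by term by the absorption identity
`succ_mul_ringChoose`. The shift in j accounts for J + 1 against J. -/
theorem tricomiSum_recurrence (a c : ℤ) (J : ℕ) {x : ℝ} (hx : 0 < x) :
    tricomiSum a c (J + 1) x
      = x * tricomiSum (a + 1) c (J + 1) x - c * tricomiSum (a + 1) (c - 1) J x := by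
  have hx0 : (x : ℂ) ≠ 0 := by exact_mod_cast hx.ne'
  rw [tricomiSum, tricomiSum, tricomiSum, Finset.sum_range_succ', Finset.sum_range_succ',
    mul_add, Finset.mul_sum, Finset.mul_sum, add_sub_right_comm, ← Finset.sum_sub_distrib]
  congr 1
  · refine Finset.sum_congr rfl fun j _ => ?_
    have h := succ_mul_ringChoose c j
    have h : ((j : ℂ) + 1) * ((Ring.choose c (j + 1) : ℤ) : ℂ)
        = (c : ℂ) * ((Ring.choose (c - 1) j : ℤ) : ℂ) := by exact_mod_cast h
    have e1 : (ascPochhammer ℂ (j + 1)).eval (a : ℂ)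
        = a * (ascPochhammer ℂ j).eval ((a : ℂ) + 1) := by
      simp [ascPochhammer_succ_left]
    have e2 : (ascPochhammer ℂ (j + 1)).eval ((a : ℂ) + 1)
        = (ascPochhammer ℂ j).eval ((a : ℂ) + 1) * (a + 1 + j) := ascPochhammer_succ_eval _ _
    push_cast
    rw [e1, e2, show -(a + 1) - ((j : ℤ) + 1) = (-a - ((j : ℤ) + 1)) - 1 by ring,
      show -(a + 1) - (j : ℤ) = -a - ((j : ℤ) + 1) by ring, zpow_sub_one₀ hx0]
    field_simp
    linear_combination (-(ascPochhammer ℂ j).eval ((a : ℂ) + 1)) * h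
  · simp only [CharP.cast_eq_zero, sub_zero, Ring.choose_zero_right, ascPochhammer_zero,
      Polynomial.eval_one]
    rw [show -(a + 1) = -a - 1 by ring, zpow_sub_one₀ hx0]
    field_simp

/-- Pascal's rule; the counterpart of `tricomi_add_one`. -/
theorem tricomiSum_add_one (a c : ℤ) (J : ℕ) (x : ℝ) :
    tricomiSum a (c + 1) (J + 1) x = tricomiSum a c (J + 1) x + a * tricomiSum (a + 1) c J x := by
  rw [tricomiSum, tricomiSum, tricomiSum, Finset.sum_range_succ', Finset.sum_range_succ',
    Finset.mul_sum, add_right_comm, ← Finset.sum_add_distrib]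
  congr 1
  · refine Finset.sum_congr rfl fun j _ => ?_
    have e1 : (ascPochhammer ℂ (j + 1)).eval (a : ℂ)
        = a * (ascPochhammer ℂ j).eval ((a : ℂ) + 1) := by
      simp [ascPochhammer_succ_left]
    rw [Ring.choose_succ_succ]
    push_cast
    rw [e1, show -(a + 1) - (j : ℤ) = -a - ((j : ℤ) + 1) by ring]
    ring
  · simp

/-- Induction from a = 0, where both sides are 1. Any J > n is allowed since (-n)_j = 0 for j > n,
so that the length can later be fitted to the inner sum. -/
theorem tricomi_neg_nat (n : ℕ) (c : ℤ) {J : ℕ} (hJ : n < J) {x : ℝ} (hx : 0 < x) :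
    tricomi (-(n : ℂ)) c x = tricomiSum (-(n : ℤ)) c J x := by
  induction n generalizing c J with
  | zero =>
    obtain ⟨J, rfl⟩ : ∃ K, J = K + 1 := ⟨J - 1, by omega⟩
    rw [tricomiSum, Finset.sum_range_succ', Finset.sum_eq_zero]
    · simp [tricomi_zero_left _ hx]
    · intro j _
      simp [ascPochhammer_succ_left]
  | succ n ih =>
    obtain ⟨J, rfl⟩ : ∃ K, J = K + 1 := ⟨J - 1, by omega⟩
    rw [tricomi_recurrence _ _ hx, tricomiSum_recurrence _ _ _ hx]
    have e : -((n + 1 : ℕ) : ℂ) + 1 = -(n : ℂ) := by push_cast; ring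
    have e' : -((n + 1 : ℕ) : ℤ) + 1 = -(n : ℤ) := by push_cast; ring
    rw [e, e', ih c (J := J + 1) (by omega), ← ih (c - 1) (J := J) (by omega)]
    push_cast
    rfl

/-- Induction on c from c = 0, where the integral is the Laplace integral with value x^(-a). -/
theorem tricomi_nat_right (a : ℤ) (ha : 0 < a) (c : ℕ) {J : ℕ} (hJ : c < J) {x : ℝ} (hx : 0 < x) :
    tricomi a c x = tricomiSum a c J x := by
  induction c generalizing a J with
  | zero =>
    obtain ⟨J, rfl⟩ : ∃ K, J = K + 1 := ⟨J - 1, by omega⟩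
    have ha' : 0 < (a : ℂ).re := by simpa using ha
    rw [tricomiSum, Finset.sum_range_succ', Finset.sum_eq_zero, Nat.cast_zero,
      tricomi_zero_right ha' hx]
    · simp [← Complex.cpow_intCast, Complex.cpow_neg]
    · intro j _
      simp [Ring.choose_zero_succ]
  | succ c ih =>
    obtain ⟨J, rfl⟩ : ∃ K, J = K + 1 := ⟨J - 1, by omega⟩
    have ha' : 0 < (a : ℂ).re := by simpa using ha
    push_cast
    rw [tricomi_add_one _ ha' hx, tricomiSum_add_one, ih a ha (J := J + 1) (by omega)]
    have := ih (a + 1) (by omega) (J := J) (by omega)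
    push_cast at this
    rw [this]

/-- At integers where the asymptotic expansion of `tricomi a c x` terminates, it is exact. -/
theorem tricomi_eq_tricomiSum {a c : ℤ} {J : ℕ} (hJ : (a ≤ 0 ∧ -a < J) ∨ (0 < a ∧ 0 ≤ c ∧ c < J))
    {x : ℝ} (hx : 0 < x) : tricomi a c x = tricomiSum a c J x := by
  rcases hJ with ⟨h1, h2⟩ | ⟨h1, h2, h3⟩
  · obtain ⟨n, rfl⟩ : ∃ n : ℕ, a = -(n : ℤ) := ⟨(-a).toNat, by omega⟩
    have := tricomi_neg_nat n c (J := J) (by omega) hx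
    push_cast
    exact this
  · lift c to ℕ using h2
    exact tricomi_nat_right a h1 c (by omega) hx

end NonholoEisenstein

/-! ### Half-line kernels: Fourier transforms and correlations. -/

namespace NonholoEisenstein
open MeasureTheory Set Filter Topology
open scoped FourierTransform Convolution

theorem integrable_exp_neg_mul_abs {c : ℝ} (hc : 0 < c) :
    Integrable (fun t : ℝ => Real.exp (-(c * |t|))) := by
  have h : Integrable ((Ici (0 : ℝ)).indicator fun t : ℝ => Real.exp (-c * t)) :=
    ((integrableOn_Ici_iff_integrableOn_Ioi (μ := volume)).2
      (exp_neg_integrableOn_Ioi 0 hc)).integrable_indicator measurableSet_Ici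
  refine (h.add h.comp_neg).mono' (by fun_prop) (Eventually.of_forall fun t => ?_)
  rw [Real.norm_of_nonneg (Real.exp_pos _).le, Pi.add_apply]
  have hnn : ∀ t : ℝ, 0 ≤ (Ici (0 : ℝ)).indicator (fun t : ℝ => Real.exp (-c * t)) t := fun t =>
    indicator_nonneg (fun t _ => (Real.exp_pos _).le) t
  rcases le_total 0 t with ht | ht
  · refine le_add_of_le_of_nonneg ?_ (hnn _)
    simp [indicator_of_mem (mem_Ici.2 ht), abs_of_nonneg ht]
  · refine le_add_of_nonneg_of_le (hnn _) ?_
    simp [indicator_of_mem (mem_Ici.2 (neg_nonneg.2 ht)), abs_of_nonpos ht]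

noncomputable section

/-- The function `t ^ (α - 1) e ^ (2 π i τ t)` on the positive reals, extended by zero. -/
def halfKernel (α τ : ℂ) (t : ℝ) : ℂ :=
  ((max t 0 : ℝ) : ℂ) ^ (α - 1) * Complex.exp (2 * Real.pi * Complex.I * τ * t)

/-- The correlation `∫ A(m + v) B(v) dv` of two half-line kernels. -/
def halfCorrelation (α τ β τ' : ℂ) (m : ℝ) : ℂ :=
  ∫ v : ℝ, halfKernel α τ (m + v) * halfKernel β τ' v

end

/-- The extension by zero is encoded by `0 ^ (α - 1) = 0`, valid as α ≠ 1. The stronger condition Re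
α > 1 makes the kernel continuous at 0, which Poisson summation will use. -/
theorem halfKernel_of_nonpos {α : ℂ} (τ : ℂ) (hα : 1 < α.re) {t : ℝ} (ht : t ≤ 0) :
    halfKernel α τ t = 0 := by
  have h : α - 1 ≠ 0 := by
    intro h
    have := congrArg Complex.re h
    simp at this
    linarith
  rw [halfKernel, max_eq_right ht, Complex.ofReal_zero, Complex.zero_cpow h, zero_mul]

theorem halfKernel_of_pos (α τ : ℂ) {t : ℝ} (ht : 0 < t) :
    halfKernel α τ t = (t : ℂ) ^ (α - 1) * Complex.exp (2 * Real.pi * Complex.I * τ * t) := by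
  rw [halfKernel, max_eq_left ht.le]

theorem continuous_halfKernel {α : ℂ} (τ : ℂ) (hα : 1 < α.re) : Continuous (halfKernel α τ) := by
  refine Continuous.mul ?_ (by fun_prop)
  exact (Complex.continuous_ofReal_cpow_const (y := α - 1) (by simpa using hα)).comp
    (continuous_id.max continuous_const)

theorem exists_norm_halfKernel_le {α τ : ℂ} (hα : 1 < α.re) (hτ : 0 < τ.im) :
    ∃ C : ℝ, 0 < C ∧ ∀ t : ℝ, ‖halfKernel α τ t‖ ≤ C * Real.exp (-(Real.pi * τ.im * |t|)) := by
  obtain ⟨N, hN⟩ := exists_nat_ge (α.re - 1)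
  have hpos : 0 < Real.pi * τ.im := mul_pos Real.pi_pos hτ
  obtain ⟨C, hC, h⟩ := one_add_pow_le_exp N hpos
  refine ⟨C, hC, fun t => ?_⟩
  rcases le_or_gt t 0 with ht | ht
  · rw [halfKernel_of_nonpos τ hα ht, norm_zero]
    positivity
  · rw [halfKernel_of_pos α τ ht, norm_mul, Complex.norm_cpow_eq_rpow_re_of_pos ht,
      Complex.norm_exp, abs_of_pos ht]
    have h1 : (2 * Real.pi * Complex.I * τ * t : ℂ).re = -(2 * (Real.pi * τ.im * t)) := by
      simp
      ring
    have h2 : t ^ (α - 1).re ≤ (1 + t) ^ N := by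
      rw [← Real.rpow_natCast]
      refine (Real.rpow_le_rpow ht.le (by linarith : t ≤ 1 + t) (by simp; linarith)).trans ?_
      exact Real.rpow_le_rpow_of_exponent_le (by linarith) (by simpa using hN)
    rw [h1]
    calc _ ≤ (C * Real.exp (Real.pi * τ.im * t)) * Real.exp (-(2 * (Real.pi * τ.im * t))) := by
          gcongr
          exact h2.trans (h t ht.le)
      _ = _ := by rw [mul_assoc, ← Real.exp_add]; ring_nf

theorem integrable_halfKernel {α τ : ℂ} (hα : 1 < α.re) (hτ : 0 < τ.im) :
    Integrable (halfKernel α τ) := by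
  obtain ⟨C, -, h⟩ := exists_norm_halfKernel_le hα hτ
  exact ((integrable_exp_neg_mul_abs (mul_pos Real.pi_pos hτ)).const_mul C).mono'
    (continuous_halfKernel τ hα).aestronglyMeasurable (Eventually.of_forall h)

/-- The Laplace integral at r = 2πi(ξ - τ), whose real part is 2π Im τ. -/
theorem fourier_halfKernel {α τ : ℂ} (hα : 1 < α.re) (hτ : 0 < τ.im) (ξ : ℝ) :
    𝓕 (halfKernel α τ) ξ
      = (1 / (2 * Real.pi * Complex.I * (ξ - τ))) ^ α * Complex.Gamma α := by
  have hr : 0 < (2 * Real.pi * Complex.I * (ξ - τ) : ℂ).re := by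
    simp
    positivity
  rw [← integral_cpow_mul_exp_neg_complex_mul_Ioi (by linarith) hr,
    Real.fourier_real_eq_integral_exp_smul,
    ← setIntegral_eq_integral_of_forall_compl_eq_zero (s := Ioi 0)]
  · refine setIntegral_congr_fun measurableSet_Ioi fun t ht => ?_
    rw [halfKernel_of_pos α τ ht, smul_eq_mul, mul_left_comm, ← Complex.exp_add]
    congr 2
    push_cast
    ring
  · intro t ht
    rw [halfKernel_of_nonpos τ hα (not_lt.1 ht), smul_zero]

/-- Shift v by m. This reduces negative Fourier modes to positive ones. -/
theorem halfCorrelation_symm (α τ β τ' : ℂ) (m : ℝ) :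
    halfCorrelation α τ β τ' m = halfCorrelation β τ' α τ (-m) := by
  rw [halfCorrelation, halfCorrelation,
    ← integral_add_left_eq_self (fun v => halfKernel β τ' (-m + v) * halfKernel α τ v) m]
  refine integral_congr_ae (Eventually.of_forall fun v => ?_)
  simp only [neg_add_cancel_left]
  exact mul_comm _ _

theorem halfCorrelation_eq_convolution (α τ β τ' : ℂ) :
    halfCorrelation α τ β τ'
      = (halfKernel α τ ⋆[ContinuousLinearMap.mul ℂ ℂ] (fun t => halfKernel β τ' (-t))) := by
  ext m
  rw [convolution_def, halfCorrelation, ← integral_add_left_eq_self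
    (fun t => ContinuousLinearMap.mul ℂ ℂ (halfKernel α τ t) (halfKernel β τ' (-(m - t)))) m]
  simp

theorem continuous_halfCorrelation {α τ β τ' : ℂ} (hα : 1 < α.re) (hτ : 0 < τ.im)
    (hβ : 1 < β.re) (hτ' : 0 < τ'.im) : Continuous (halfCorrelation α τ β τ') := by
  rw [halfCorrelation_eq_convolution]
  refine BddAbove.continuous_convolution_right_of_integrable _ ?_ (integrable_halfKernel hα hτ)
    ((continuous_halfKernel τ' hβ).comp continuous_neg)
  obtain ⟨C, hC, h⟩ := exists_norm_halfKernel_le hβ hτ'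
  refine ⟨C, ?_⟩
  rintro _ ⟨t, rfl⟩
  refine (h _).trans (mul_le_of_le_one_right hC.le (Real.exp_le_one_iff.2 ?_))
  have := mul_pos Real.pi_pos hτ'
  have : 0 ≤ Real.pi * τ'.im * |-t| := by positivity
  linarith

theorem fourier_halfCorrelation {α τ β τ' : ℂ} (hα : 1 < α.re) (hτ : 0 < τ.im)
    (hβ : 1 < β.re) (hτ' : 0 < τ'.im) (ξ : ℝ) :
    𝓕 (halfCorrelation α τ β τ') ξ = 𝓕 (halfKernel α τ) ξ * 𝓕 (halfKernel β τ') (-ξ) := by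
  rw [halfCorrelation_eq_convolution, Real.fourier_mul_convolution_eq (integrable_halfKernel hα hτ)
    ((integrable_halfKernel hβ hτ').comp_neg)]
  congr 1
  rw [Real.fourier_real_eq_integral_exp_smul, Real.fourier_real_eq_integral_exp_smul,
    ← integral_neg_eq_self]
  simp

theorem isBigO_halfCorrelation {α τ β τ' : ℂ} (hα : 1 < α.re) (hτ : 0 < τ.im)
    (hβ : 1 < β.re) (hτ' : 0 < τ'.im) :
    halfCorrelation α τ β τ' =O[cocompact ℝ] fun x : ℝ => |x| ^ (-2 : ℝ) := by
  obtain ⟨C, hC, h⟩ := exists_norm_halfKernel_le hα hτ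
  obtain ⟨C', hC', h'⟩ := exists_norm_halfKernel_le hβ hτ'
  set c := min (Real.pi * τ.im) (Real.pi * τ'.im) with hcdef
  have hc : 0 < c := lt_min (mul_pos Real.pi_pos hτ) (mul_pos Real.pi_pos hτ')
  have hc1 : c ≤ Real.pi * τ.im := min_le_left _ _
  have hc2 : c ≤ Real.pi * τ'.im := min_le_right _ _
  have hI := integrable_exp_neg_mul_abs (half_pos hc)
  set I := ∫ t : ℝ, Real.exp (-(c / 2 * |t|))
  have hb : ∀ m : ℝ, ‖halfCorrelation α τ β τ' m‖
      ≤ C * C' * Real.exp (-(c / 2 * |m|)) * I := by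
    intro m
    rw [← integral_const_mul]
    refine norm_integral_le_of_norm_le (hI.const_mul _) (Eventually.of_forall fun v => ?_)
    rw [norm_mul]
    calc _ ≤ (C * Real.exp (-(c * |m + v|))) * (C' * Real.exp (-(c * |v|))) := by
          refine mul_le_mul ((h _).trans ?_) ((h' _).trans ?_) (norm_nonneg _) (by positivity)
          · gcongr
          · gcongr
      _ = C * C' * (Real.exp (-(c * |m + v|) + -(c * |v|))) := by rw [Real.exp_add]; ring
      _ ≤ C * C' * (Real.exp (-(c / 2 * |m|) + -(c / 2 * |v|))) := by
          refine mul_le_mul_of_nonneg_left (Real.exp_le_exp.2 ?_) (by positivity)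
          -- Half of the exponent pays for the decay in m; the remaining half of c|v| keeps the
          -- bound integrable in v.
          have h1 : |m| ≤ |m + v| + |v| := by
            simpa using abs_add_le (m + v) (-v)
          have h2 := abs_nonneg (m + v)
          nlinarith
      _ = _ := by rw [Real.exp_add]; ring
  have h1 : (fun x : ℝ => Real.exp (-(c / 2) * |x|)) =O[cocompact ℝ]
      fun x : ℝ => |x| ^ (-2 : ℝ) :=
    (isLittleO_exp_neg_mul_rpow_atTop (half_pos hc) (-2)).isBigO.comp_tendsto
      (tendsto_norm_cocompact_atTop (E := ℝ))
  refine Asymptotics.IsBigO.trans (Asymptotics.IsBigO.of_bound (C * C' * I)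
    (Eventually.of_forall fun m => ?_)) h1
  rw [Real.norm_of_nonneg (Real.exp_pos _).le]
  refine (hb m).trans (le_of_eq ?_)
  rw [neg_mul]
  ring

theorem summable_halfCorrelation {α τ β τ' : ℂ} (hα : 1 < α.re) (hτ : 0 < τ.im)
    (hβ : 1 < β.re) (hτ' : 0 < τ'.im) : Summable fun n : ℤ => halfCorrelation α τ β τ' n :=
  summable_of_isBigO (Real.summable_abs_int_rpow (b := 2) (by norm_num))
    ((isBigO_halfCorrelation hα hτ hβ hτ').comp_tendsto Int.tendsto_coe_cofinite)

theorem tsum_halfCorrelation {α τ β τ' : ℂ} (hα : 1 < α.re) (hτ : 0 < τ.im)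
    (hβ : 1 < β.re) (hτ' : 0 < τ'.im)
    (hs : Summable fun n : ℤ => 𝓕 (halfKernel α τ) n * 𝓕 (halfKernel β τ') (-n)) :
    ∑' n : ℤ, halfCorrelation α τ β τ' n
      = ∑' n : ℤ, 𝓕 (halfKernel α τ) n * 𝓕 (halfKernel β τ') (-n) := by
  have hF : ∀ n : ℤ, 𝓕 (halfCorrelation α τ β τ') n
      = 𝓕 (halfKernel α τ) n * 𝓕 (halfKernel β τ') (-n) := fun n =>
    fourier_halfCorrelation hα hτ hβ hτ' n
  have := Real.tsum_eq_tsum_fourier_of_rpow_decay_of_summable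
    (continuous_halfCorrelation hα hτ hβ hτ') (b := 2) (by norm_num)
    (isBigO_halfCorrelation hα hτ hβ hτ') (by simpa only [hF] using hs) 0
  simpa [hF] using this

/-- Substitute v ↦ mv. Because the second parameter is minus the conjugate of τ, the exponentials
combine to e^(2πiτm) e^(-4πm Im τ v), leaving a Tricomi integral. -/
theorem halfCorrelation_conj_of_pos {α τ β : ℂ} (hβ : 1 < β.re) (hτ : 0 < τ.im)
    {m : ℝ} (hm : 0 < m) :
    halfCorrelation α τ β (-(starRingEnd ℂ) τ) m
      = Complex.exp (2 * Real.pi * Complex.I * τ * m) * (m : ℂ) ^ (α + β - 1) *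
        (Complex.Gamma β * tricomi β (α - 1) (4 * Real.pi * m * τ.im)) := by
  have hx : 0 < 4 * Real.pi * m * τ.im := by have := Real.pi_pos; positivity
  have hG : Complex.Gamma β ≠ 0 := Complex.Gamma_ne_zero_of_re_pos (by linarith)
  have hm0 : (m : ℂ) ≠ 0 := by exact_mod_cast hm.ne'
  rw [tricomi_of_re_pos _ (by linarith) hx, mul_inv_cancel_left₀ hG, halfCorrelation,
    ← setIntegral_eq_integral_of_forall_compl_eq_zero (s := Ioi 0)]
  · rw [← mul_zero m, ← integral_comp_mul_left_Ioi' _ _ hm, tricomiIntegral, Complex.real_smul,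
      ← integral_const_mul, ← integral_const_mul]
    refine setIntegral_congr_fun measurableSet_Ioi fun v hv => ?_
    have hv : 0 < v := hv
    rw [halfKernel_of_pos _ _ (by positivity), halfKernel_of_pos _ _ (by positivity)]
    have e1 : ((m + m * v : ℝ) : ℂ) ^ (α - 1) = (m : ℂ) ^ (α - 1) * ((1 + v : ℝ) : ℂ) ^ (α - 1) := by
      rw [← Complex.mul_cpow_ofReal_nonneg hm.le (by positivity)]
      congr 1
      push_cast
      ring
    have e2 : ((m * v : ℝ) : ℂ) ^ (β - 1) = (m : ℂ) ^ (β - 1) * (v : ℂ) ^ (β - 1) := by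
      rw [← Complex.mul_cpow_ofReal_nonneg hm.le hv.le]
      push_cast
      rfl
    have e3 : (m : ℂ) ^ (α + β - 1) = m * ((m : ℂ) ^ (α - 1) * (m : ℂ) ^ (β - 1)) := by
      rw [show α + β - 1 = 1 + ((α - 1) + (β - 1)) by ring, Complex.cpow_add _ _ hm0,
        Complex.cpow_add _ _ hm0, Complex.cpow_one]
    have e4 : Complex.exp (2 * Real.pi * Complex.I * τ * (m + m * v : ℝ)) *
        Complex.exp (2 * Real.pi * Complex.I * -(starRingEnd ℂ) τ * (m * v : ℝ))
        = Complex.exp (2 * Real.pi * Complex.I * τ * m) *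
          Complex.exp (-((4 * Real.pi * m * τ.im : ℝ) * v)) := by
      rw [← Complex.exp_add, ← Complex.exp_add]
      congr 1
      have h := Complex.sub_conj τ
      push_cast at h ⊢
      linear_combination (2 * Real.pi * Complex.I * (m * v)) * h +
        (4 * Real.pi * m * v * τ.im) * Complex.I_sq
    rw [e1, e2, e3]
    linear_combination (m * ((m : ℂ) ^ (α - 1) * (m : ℂ) ^ (β - 1)) *
      ((v : ℂ) ^ (β - 1) * ((1 + v : ℝ) : ℂ) ^ (α - 1))) * e4
  · intro v hv
    rw [halfKernel_of_nonpos (α := β) _ hβ (not_lt.1 hv), mul_zero]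

theorem halfCorrelation_conj_zero {α τ β : ℂ} (hα : 1 < α.re) (hβ : 1 < β.re) (hτ : 0 < τ.im) :
    halfCorrelation α τ β (-(starRingEnd ℂ) τ) 0
      = (4 * Real.pi * τ.im : ℂ) ^ (1 - α - β) * Complex.Gamma (α + β - 1) := by
  have hx : 0 < 4 * Real.pi * τ.im := by have := Real.pi_pos; positivity
  have h1 := Complex.integral_cpow_mul_exp_neg_mul_Ioi (a := α + β - 1)
    (by simp; linarith) hx
  have e5 : (1 / ((4 * Real.pi * τ.im : ℝ) : ℂ)) ^ (α + β - 1)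
      = (4 * Real.pi * τ.im : ℂ) ^ (1 - α - β) := by
    rw [one_div, Complex.inv_cpow _ _
      (by rw [Complex.arg_ofReal_of_nonneg hx.le]; exact Real.pi_pos.ne), ← Complex.cpow_neg]
    push_cast
    ring_nf
  rw [e5] at h1
  rw [← h1, halfCorrelation, ← setIntegral_eq_integral_of_forall_compl_eq_zero (s := Ioi 0)]
  · refine setIntegral_congr_fun measurableSet_Ioi fun v hv => ?_
    have hv : 0 < v := hv
    have hv0 : (v : ℂ) ≠ 0 := by exact_mod_cast hv.ne'
    simp only [zero_add]
    rw [halfKernel_of_pos _ _ hv, halfKernel_of_pos _ _ hv,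
      show α + β - 1 - 1 = (α - 1) + (β - 1) by ring, Complex.cpow_add _ _ hv0]
    have e4 : Complex.exp (2 * Real.pi * Complex.I * τ * v) *
        Complex.exp (2 * Real.pi * Complex.I * -(starRingEnd ℂ) τ * v)
        = Complex.exp (-((4 * Real.pi * τ.im : ℝ) * v)) := by
      rw [← Complex.exp_add]
      congr 1
      have h := Complex.sub_conj τ
      push_cast at h ⊢
      linear_combination (2 * Real.pi * Complex.I * v) * h +
        (4 * Real.pi * v * τ.im) * Complex.I_sq
    rw [← e4]
    ring
  · intro v hv
    rw [halfKernel_of_nonpos (α := β) _ hβ (not_lt.1 hv), mul_zero]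

end NonholoEisenstein

/-! ### Poisson summation over a horizontal line of lattice points. -/

namespace NonholoEisenstein
open MeasureTheory Set Filter Topology
open scoped FourierTransform Convolution

noncomputable section

/-- The function `(w / |w|) ^ (-k) |w| ^ (-2 s)`, to be summed over the lattice points `w`. -/
def latticeTerm (k : ℤ) (s w : ℂ) : ℂ := (w / (‖w‖ : ℂ)) ^ (-k) * (‖w‖ : ℂ) ^ (-(2 * s))

/-- The summand `e ^ (2 π i m τ) m ^ (2 s - 1) U(m y)` of the non-constant Fourier terms, with the
Whittaker type function `U(x) = tricomi (s - κ) (s + κ - 1) (4 π x)`. -/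
def whittakerTerm (κ : ℤ) (s τ : ℂ) (m : ℕ) : ℂ :=
  Complex.exp (2 * Real.pi * Complex.I * τ * m) * (m : ℂ) ^ (2 * s - 1) *
    tricomi (s - κ) (s + κ - 1) (4 * Real.pi * m * τ.im)

end

/-- Since Re q > 0, the argument is not π and the logarithm commutes with conjugation; the powers
with exponent s therefore multiply to |q|^(2s), also for complex s. -/
theorem cpow_add_mul_conj_cpow_sub {q : ℂ} (hq : 0 < q.re) (s : ℂ) (κ : ℤ) :
    q ^ (s + κ) * (starRingEnd ℂ) q ^ (s - κ)
      = (q / (starRingEnd ℂ) q) ^ κ * (‖q‖ : ℂ) ^ (2 * s) := by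
  have hq0 : q ≠ 0 := by rintro rfl; simp at hq
  have hc0 : (starRingEnd ℂ) q ≠ 0 := by simpa using hq0
  have hn0 : (‖q‖ : ℂ) ≠ 0 := by simpa using hq0
  have harg : q.arg ≠ Real.pi := by
    intro h
    have := (Complex.arg_eq_pi_iff.1 h).1
    linarith
  rw [Complex.cpow_add _ _ hq0, Complex.cpow_sub _ _ hc0, Complex.cpow_intCast,
    Complex.cpow_intCast, div_zpow]
  have key : q ^ s * (starRingEnd ℂ) q ^ s = (‖q‖ : ℂ) ^ (2 * s) := by
    rw [Complex.cpow_def_of_ne_zero hq0, Complex.cpow_def_of_ne_zero hc0,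
      Complex.cpow_def_of_ne_zero hn0, Complex.log_conj _ harg, ← Complex.exp_add, ← add_mul,
      Complex.add_conj, Complex.log_re, ← Complex.ofReal_log (norm_nonneg _)]
    congr 1
    push_cast
    ring
  rw [← key]
  ring

/-- The left side is the shape of the two kernel transforms. Its first base q has Re q > 0 because
Im w > 0, its second is the conjugate of q, and their quotient is -(w/|w|)^(-2), whence the sign
(-1)^κ. -/
theorem latticeTerm_eq_cpow_mul {w : ℂ} (hw : 0 < w.im) (s : ℂ) (κ : ℤ) :
    (1 / (2 * Real.pi * Complex.I * (-w))) ^ (s + κ) *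
        (1 / (2 * Real.pi * Complex.I * (starRingEnd ℂ) w)) ^ (s - κ)
      = (2 * Real.pi : ℂ) ^ (-(2 * s)) * (-1) ^ κ * latticeTerm (2 * κ) s w := by
  have hw0 : w ≠ 0 := by rintro rfl; simp at hw
  have hcw0 : (starRingEnd ℂ) w ≠ 0 := by simpa using hw0
  have hn : (0 : ℝ) < ‖w‖ := norm_pos_iff.2 hw0
  have hn0 : (‖w‖ : ℂ) ≠ 0 := by exact_mod_cast hn.ne'
  have hpi : (Real.pi : ℂ) ≠ 0 := by exact_mod_cast Real.pi_ne_zero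
  set q := 1 / (2 * Real.pi * Complex.I * (-w)) with hq
  have hcq : 1 / (2 * Real.pi * Complex.I * (starRingEnd ℂ) w) = (starRingEnd ℂ) q := by
    simp [hq, map_ofNat (starRingEnd ℂ) 2]
  have hqre : 0 < q.re := by
    have h : 0 < (2 * Real.pi * Complex.I * (-w)).re := by
      simp
      positivity
    have h0 : (2 * Real.pi * Complex.I * (-w)) ≠ 0 := by
      intro h0
      rw [h0] at h
      simp at h
    rw [hq, one_div, Complex.inv_re]
    have := Complex.normSq_pos.2 h0
    positivity
  rw [hcq, cpow_add_mul_conj_cpow_sub hqre, ← hcq]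
  have hnorm : ‖q‖ = (2 * Real.pi * ‖w‖)⁻¹ := by
    simp [hq, abs_of_pos Real.pi_pos]
  have e1 : (‖q‖ : ℂ) ^ (2 * s) = (2 * Real.pi : ℂ) ^ (-(2 * s)) * (‖w‖ : ℂ) ^ (-(2 * s)) := by
    have h2 : (2 * Real.pi : ℂ) = ((2 * Real.pi : ℝ) : ℂ) := by push_cast; rfl
    rw [hnorm, Complex.ofReal_inv, Complex.inv_cpow _ _ (by
      rw [Complex.arg_ofReal_of_nonneg (by positivity)]; exact Real.pi_pos.ne), ← Complex.cpow_neg,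
      Complex.ofReal_mul, Complex.mul_cpow_ofReal_nonneg (by positivity) hn.le, h2]
  have e2 : q / (1 / (2 * Real.pi * Complex.I * (starRingEnd ℂ) w))
      = (-1) * (w / (‖w‖ : ℂ)) ^ (-2 : ℤ) := by
    have hcc : w * (starRingEnd ℂ) w = (‖w‖ : ℂ) ^ 2 := Complex.mul_conj' w
    rw [hq, zpow_neg, div_zpow]
    have hI := Complex.I_ne_zero
    field_simp
    norm_cast
    push_cast
    linear_combination -hcc
  rw [e1, e2, mul_zpow, ← zpow_mul, latticeTerm, neg_mul]
  ring

theorem two_lt_re_add_int {s : ℂ} {κ : ℤ} (hs : |(κ : ℝ)| + 1 < s.re) :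
    1 < (s + κ).re ∧ 1 < (s - κ).re := by
  have h1 := neg_abs_le (κ : ℝ)
  have h2 := le_abs_self (κ : ℝ)
  constructor
  · simp; linarith
  · simp; linarith

/-- Poisson summation for the lattice sum over a horizontal line. -/
theorem tsum_latticeTerm_add_int {s τ : ℂ} {κ : ℤ} (hs : |(κ : ℝ)| + 1 < s.re) (hτ : 0 < τ.im)
    (hsum : Summable fun n : ℤ => latticeTerm (2 * κ) s (τ + n)) :
    Complex.Gamma (s + κ) * Complex.Gamma (s - κ) * (2 * Real.pi : ℂ) ^ (-(2 * s)) * (-1) ^ κ *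
        ∑' n : ℤ, latticeTerm (2 * κ) s (τ + n)
      = (4 * Real.pi * τ.im : ℂ) ^ (1 - 2 * s) * Complex.Gamma (2 * s - 1)
        + Complex.Gamma (s - κ) * ∑' m : ℕ+, whittakerTerm κ s τ m
        + Complex.Gamma (s + κ) * ∑' m : ℕ+, whittakerTerm (-κ) s (-(starRingEnd ℂ) τ) m := by
  obtain ⟨hα, hβ⟩ := two_lt_re_add_int hs
  have hτ' : 0 < (-(starRingEnd ℂ) τ).im := by simpa using hτ
  -- The transforms at n give the lattice point τ - n; the sum is reindexed by n ↦ -n below.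
  have hF : ∀ n : ℤ, 𝓕 (halfKernel (s + κ) τ) n * 𝓕 (halfKernel (s - κ) (-(starRingEnd ℂ) τ)) (-n)
      = Complex.Gamma (s + κ) * Complex.Gamma (s - κ) * (2 * Real.pi : ℂ) ^ (-(2 * s)) *
        (-1) ^ κ * latticeTerm (2 * κ) s (τ + ((-n : ℤ) : ℂ)) := by
    intro n
    have hw : 0 < (τ + ((-n : ℤ) : ℂ)).im := by simpa using hτ
    have h := latticeTerm_eq_cpow_mul hw s κ
    rw [fourier_halfKernel hα hτ, fourier_halfKernel hβ hτ']
    have e1 : (2 * Real.pi * Complex.I * (((n : ℝ) : ℂ) - τ))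
        = 2 * Real.pi * Complex.I * (-(τ + ((-n : ℤ) : ℂ))) := by
      push_cast; ring
    have e2 : (2 * Real.pi * Complex.I * (((-(n : ℝ) : ℝ) : ℂ) - (-(starRingEnd ℂ) τ)))
        = 2 * Real.pi * Complex.I * (starRingEnd ℂ) (τ + ((-n : ℤ) : ℂ)) := by
      simp; ring
    rw [e1, e2]
    linear_combination (Complex.Gamma (s + κ) * Complex.Gamma (s - κ)) * h
  have hsum' : Summable fun n : ℤ => latticeTerm (2 * κ) s (τ + ((-n : ℤ) : ℂ)) :=
    (Equiv.neg ℤ).summable_iff.2 hsum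
  have hP := tsum_halfCorrelation hα hτ hβ hτ' (by simpa only [hF] using hsum'.mul_left _)
  simp only [hF] at hP
  rw [tsum_mul_left] at hP
  have hneg : ∑' n : ℤ, latticeTerm (2 * κ) s (τ + ((-n : ℤ) : ℂ))
      = ∑' n : ℤ, latticeTerm (2 * κ) s (τ + n) :=
    (Equiv.neg ℤ).tsum_eq (fun n : ℤ => latticeTerm (2 * κ) s (τ + n))
  rw [hneg] at hP
  -- The modes m < 0 are, by `halfCorrelation_symm`, positive modes with κ replaced by -κ and τ by
  -- minus its conjugate.
  rw [← hP, tsum_int_eq_zero_add_tsum_pnat (summable_halfCorrelation hα hτ hβ hτ')]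
  congr 1
  · congr 1
    · rw [Int.cast_zero, halfCorrelation_conj_zero hα hβ hτ]
      ring_nf
    · rw [← tsum_mul_left]
      refine tsum_congr fun m => ?_
      have hm : (0 : ℝ) < (m : ℕ) := by exact_mod_cast m.pos
      have := halfCorrelation_conj_of_pos (α := s + κ) hβ hτ hm
      rw [Int.cast_natCast, this, whittakerTerm]
      push_cast
      rw [show s + κ + (s - κ) - 1 = 2 * s - 1 by ring]
      ring
  · rw [← tsum_mul_left]
    refine tsum_congr fun m => ?_
    have hm : (0 : ℝ) < (m : ℕ) := by exact_mod_cast m.pos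
    have := halfCorrelation_conj_of_pos (α := s - κ) hα hτ' hm
    rw [map_neg, Complex.conj_conj, neg_neg] at this
    rw [halfCorrelation_symm, Int.cast_neg, neg_neg, Int.cast_natCast, this, whittakerTerm]
    push_cast
    rw [show s - κ + (s + κ) - 1 = 2 * s - 1 by ring, show s - -(κ : ℂ) = s + κ by ring,
      show s + -(κ : ℂ) - 1 = s - κ - 1 by ring]
    ring

end NonholoEisenstein

/-! ### The Eisenstein series as a lattice sum. -/

namespace NonholoEisenstein
open MeasureTheory Set Filter Topology
open EisensteinSeries

theorem latticeTerm_zero (k : ℤ) {s : ℂ} (hs : s ≠ 0) : latticeTerm k s 0 = 0 := by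
  rw [latticeTerm, norm_zero, Complex.ofReal_zero, Complex.zero_cpow (by simpa using hs), mul_zero]

theorem norm_latticeTerm (k : ℤ) {s : ℂ} (hs : s.re ≠ 0) (w : ℂ) :
    ‖latticeTerm k s w‖ = ‖w‖ ^ (-(2 * s.re)) := by
  have hs0 : s ≠ 0 := by rintro rfl; simp at hs
  rcases eq_or_ne w 0 with rfl | hw
  · rw [latticeTerm_zero k hs0, norm_zero, Real.zero_rpow (by simpa using hs)]
  · have h := norm_pos_iff.2 hw
    rw [latticeTerm, norm_mul, norm_zpow, norm_div, Complex.norm_real, norm_norm,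
      div_self h.ne', one_zpow, one_mul, Complex.norm_cpow_eq_rpow_re_of_pos h]
    simp

theorem latticeTerm_nat_mul (k : ℤ) (s w : ℂ) {n : ℕ} (hn : n ≠ 0) :
    latticeTerm k s (n * w) = 1 / (n : ℂ) ^ (2 * s) * latticeTerm k s w := by
  have hn0 : (n : ℂ) ≠ 0 := by exact_mod_cast hn
  have h : ((n : ℝ) : ℂ) = (n : ℂ) := by simp
  rw [latticeTerm, latticeTerm, norm_mul, Complex.norm_natCast, Complex.ofReal_mul,
    Complex.mul_cpow_ofReal_nonneg (by positivity) (norm_nonneg _), h,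
    mul_div_mul_left _ _ hn0, Complex.cpow_neg (n : ℂ), one_div]
  ring

theorem latticeTerm_neg {k : ℤ} (hk : Even k) (s w : ℂ) :
    latticeTerm k s (-w) = latticeTerm k s w := by
  rw [latticeTerm, latticeTerm, norm_neg, neg_div, hk.neg.neg_zpow]

theorem latticeTerm_natCast (k : ℤ) (s : ℂ) {n : ℕ} (hn : n ≠ 0) :
    latticeTerm k s n = 1 / (n : ℂ) ^ (2 * s) := by
  have := latticeTerm_nat_mul k s 1 hn
  rw [mul_one] at this
  rw [this, latticeTerm]
  simp

theorem summable_norm_latticeTerm (k : ℤ) (z : ℍ) {s : ℂ} (hs : 1 < s.re) :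
    Summable fun v : Fin 2 → ℤ => ‖latticeTerm k s (v 0 * (z : ℂ) + v 1)‖ := by
  have h := (summable_one_div_norm_rpow (k := 2 * s.re) (by linarith)).mul_left
    (r z ^ (-(2 * s.re)))
  refine Summable.of_nonneg_of_le (fun v => norm_nonneg _) (fun v => ?_) h
  rw [norm_latticeTerm k (by linarith)]
  exact summand_bound z (by linarith) v

theorem eisensteinTerm_eq_latticeTerm (k : ℤ) (z : ℍ) (s : ℂ) (γ : SL(2, ℤ)) :
    eisensteinTerm k z s γ = (z.im : ℂ) ^ s * latticeTerm k s (γ 1 0 * (z : ℂ) + γ 1 1) := by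
  have hden : UpperHalfPlane.denom (γ : GL (Fin 2) ℝ) z = autFactor γ z := by
    simp [UpperHalfPlane.denom, autFactor]
  have hj : autFactor γ z ≠ 0 := by
    rw [← hden]
    exact UpperHalfPlane.denom_ne_zero _ _
  have hn : 0 < ‖autFactor γ z‖ := norm_pos_iff.2 hj
  have him : (γ • z).im = z.im * (‖autFactor γ z‖ ^ 2)⁻¹ := by
    rw [ModularGroup.im_smul_eq_div_normSq, hden, Complex.normSq_eq_norm_sq, div_eq_mul_inv]
  rw [eisensteinTerm, him, latticeTerm, Complex.ofReal_mul,
    Complex.mul_cpow_ofReal_nonneg z.im_pos.le (by positivity)]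
  have e : (((‖autFactor γ z‖ ^ 2)⁻¹ : ℝ) : ℂ) ^ s = (‖autFactor γ z‖ : ℂ) ^ (-(2 * s)) := by
    have h0 : (‖autFactor γ z‖ : ℂ) ≠ 0 := by exact_mod_cast hn.ne'
    rw [Complex.ofReal_inv, Complex.inv_cpow _ _ (by
      rw [Complex.arg_ofReal_of_nonneg (by positivity)]; exact Real.pi_pos.ne), Complex.cpow_neg,
      Complex.ofReal_pow, Complex.cpow_ofNat_mul]
    congr 1
    rw [← Complex.ofReal_pow, pow_two, Complex.ofReal_mul,
      Complex.mul_cpow_ofReal_nonneg hn.le hn.le, pow_two]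
  rw [e]
  simp only [autFactor]
  ring

theorem mem_gammaInfty_of_apply_eq_zero {δ : SL(2, ℤ)} (h : δ 1 0 = 0) : δ ∈ gammaInfty := by
  have hdet := δ.det_coe
  rw [Matrix.det_fin_two, h, mul_zero, sub_zero] at hdet
  rcases Int.mul_eq_one_iff_eq_one_or_neg_one.1 hdet with ⟨h0, h1⟩ | ⟨h0, h1⟩
  · refine ⟨δ 0 1, Or.inl ?_⟩
    ext i j
    fin_cases i <;> fin_cases j <;> simp [h, h0, h1, ModularGroup.coe_T_zpow]
  · refine ⟨-δ 0 1, Or.inr ?_⟩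
    ext i j
    fin_cases i <;> fin_cases j <;> simp [h, h0, h1, ModularGroup.coe_T_zpow]

/-- The hypothesis says that the lower left entry of γ' γ⁻¹ is zero. -/
theorem mk_eq_mk_of_bottom_row {γ γ' : SL(2, ℤ)} (h : γ' 1 0 * γ 1 1 = γ' 1 1 * γ 1 0) :
    (Quotient.mk _ γ : Cosets) = Quotient.mk _ γ' := by
  refine Quotient.sound ?_
  change QuotientGroup.rightRel gammaInfty γ γ'
  rw [QuotientGroup.rightRel_apply]
  refine mem_gammaInfty_of_apply_eq_zero ?_
  rw [Matrix.SpecialLinearGroup.coe_mul, Matrix.SpecialLinearGroup.coe_inv, Matrix.adjugate_fin_two,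
    Matrix.mul_apply, Fin.sum_univ_two]
  simp only [Matrix.of_apply, Matrix.cons_val', Matrix.cons_val_zero, Matrix.cons_val_one,
    Matrix.cons_val_fin_one]
  linear_combination h

theorem bottom_row_eq_or_neg {γ γ' : SL(2, ℤ)}
    (h : QuotientGroup.rightRel gammaInfty γ γ') : ∃ ε : ℤˣ, γ' 1 = (ε : ℤ) • γ 1 := by
  rw [QuotientGroup.rightRel_apply] at h
  obtain ⟨n, hn⟩ := h
  have h0 : (ModularGroup.T ^ n * γ) 1 = γ 1 := by
    ext j
    simp
  rcases hn with hn | hn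
  · have : γ' = ModularGroup.T ^ n * γ := by rw [← hn]; simp
    exact ⟨1, by rw [this, h0]; simp⟩
  · have : γ' = -(ModularGroup.T ^ n * γ) := by rw [← neg_mul, ← hn]; simp
    refine ⟨-1, ?_⟩
    rw [this, Matrix.SpecialLinearGroup.coe_neg]
    ext j
    have := congrFun h0 j
    simp only [Matrix.neg_apply, this]
    simp

/-- The coprime pair attached to a coset and a sign. -/
noncomputable def cosetRow (p : Cosets × ℤˣ) : gammaSet 1 1 0 :=
  ⟨(p.2 : ℤ) • (p.1.out : SL(2, ℤ)) 1, by
    rw [mem_gammaSet_one]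
    have h := ModularGroup.bottom_row_coprime p.1.out
    simp only [Pi.smul_apply, smul_eq_mul]
    exact (isCoprime_mul_unit_left p.2.isUnit _ _).2 h⟩

/-- A coset determines its bottom row up to sign, and the unit supplies the sign. The set `gammaSet
1 1 0` is that of all coprime pairs, the congruence modulo 1 being vacuous. -/
theorem cosetRow_bijective : Function.Bijective cosetRow := by
  constructor
  · rintro ⟨q, ε⟩ ⟨q', ε'⟩ h
    have h := congrArg Subtype.val h
    simp only [cosetRow] at h
    have hq : q = q' := by
      rw [← Quotient.out_eq q, ← Quotient.out_eq q']
      refine mk_eq_mk_of_bottom_row ?_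
      have h0 := congrFun h 0
      have h1 := congrFun h 1
      simp only [Pi.smul_apply, smul_eq_mul] at h0 h1
      have hε : (ε : ℤ) * ε = 1 := by
        rw [← Units.val_mul, Int.units_mul_self, Units.val_one]
      have hε' : (ε' : ℤ) * ε' = 1 := by
        rw [← Units.val_mul, Int.units_mul_self, Units.val_one]
      have e0 : q'.out 1 0 = ε' * ε * q.out 1 0 := by
        linear_combination (-(ε' : ℤ)) * h0 - q'.out 1 0 * hε'
      have e1 : q'.out 1 1 = ε' * ε * q.out 1 1 := by
        linear_combination (-(ε' : ℤ)) * h1 - q'.out 1 1 * hε'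
      rw [e0, e1]
      ring
    subst hq
    have hcop := ModularGroup.bottom_row_coprime q.out
    have hne : q.out 1 ≠ 0 := by
      intro h0
      rw [h0] at hcop
      exact not_isCoprime_zero_zero hcop
    have : (ε : ℤ) = ε' := smul_left_injective ℤ hne h
    rw [Units.ext this]
  · rintro ⟨v, hv⟩
    rw [mem_gammaSet_one] at hv
    obtain ⟨γ, -, hγ⟩ := ModularGroup.bottom_row_surj hv
    obtain ⟨ε, hε⟩ := bottom_row_eq_or_neg (Quotient.exact
      (Quotient.out_eq (Quotient.mk (QuotientGroup.rightRel gammaInfty) γ)))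
    refine ⟨(Quotient.mk _ γ, ε), Subtype.ext ?_⟩
    simp only [cosetRow]
    rw [← hε]
    exact hγ

theorem summable_latticeTerm_coset (k : ℤ) (z : ℍ) {s : ℂ} (hs : 1 < s.re) :
    Summable fun q : Cosets => ‖latticeTerm k s ((q.out : SL(2, ℤ)) 1 0 * (z : ℂ) + q.out 1 1)‖ := by
  have h := (summable_norm_latticeTerm k z hs).comp_injective
    (Subtype.val_injective.comp (cosetRow_bijective.1.comp (Prod.mk_left_injective (1 : ℤˣ))))
  refine h.congr fun q => ?_
  simp [cosetRow]

theorem tsum_gammaSet_latticeTerm {k : ℤ} (hk : Even k) (z : ℍ) {s : ℂ} (hs : 1 < s.re) :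
    ∑' v : gammaSet 1 1 0, latticeTerm k s (v.1 0 * (z : ℂ) + v.1 1)
      = 2 * ∑' q : Cosets, latticeTerm k s ((q.out : SL(2, ℤ)) 1 0 * (z : ℂ) + q.out 1 1) := by
  have hS : Summable fun p : Cosets × ℤˣ =>
      latticeTerm k s ((cosetRow p).1 0 * (z : ℂ) + (cosetRow p).1 1) :=
    ((summable_norm_latticeTerm k z hs).of_norm).comp_injective
      (Subtype.val_injective.comp cosetRow_bijective.1)
  rw [← (Equiv.ofBijective _ cosetRow_bijective).tsum_eq]
  simp only [Equiv.ofBijective_apply]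
  rw [hS.tsum_prod, ← tsum_mul_left]
  refine tsum_congr fun q => ?_
  rw [tsum_fintype, UnitsInt.univ, Finset.sum_pair (by decide)]
  have : latticeTerm k s ((cosetRow (q, -1)).1 0 * (z : ℂ) + (cosetRow (q, -1)).1 1)
      = latticeTerm k s ((cosetRow (q, 1)).1 0 * (z : ℂ) + (cosetRow (q, 1)).1 1) := by
    rw [← latticeTerm_neg hk]
    congr 1
    simp [cosetRow]
    ring
  rw [this, ← two_mul]
  simp [cosetRow]

/-- A sum over all integer vectors of a homogeneous function is a zeta value times the sum over the
primitive vectors. -/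
theorem tsum_fin_two_eq_zeta_mul {f : (Fin 2 → ℤ) → ℂ} {s : ℂ} (hs : 1 < s.re)
    (hf : Summable fun v => ‖f v‖) (h0 : f 0 = 0)
    (hmul : ∀ n : ℕ, n ≠ 0 → ∀ v, f (n • v) = 1 / (n : ℂ) ^ s * f v) :
    ∑' v, f v = riemannZeta s * ∑' v : gammaSet 1 1 0, f v := by
  have hs0 : s ≠ 0 := by
    rintro rfl
    rw [Complex.zero_re] at hs
    linarith
  have hZ : Summable fun n : ℕ => ‖1 / (n : ℂ) ^ s‖ :=
    (Complex.summable_one_div_nat_cpow.2 hs).norm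
  have hC : Summable fun v : gammaSet 1 1 0 => ‖f v‖ := hf.subtype _
  have hM := summable_mul_of_summable_norm hZ hC
  -- Integer vectors are sorted by their gcd r; those with gcd r ≠ 0 are r times the primitive ones.
  have hS : Summable fun p : Σ r : ℕ, gammaSet 1 r 0 => f p.2 :=
    gammaSetDivGcdSigmaEquiv.symm.summable_iff.2 hf.of_norm
  have e1 : ∑' v, f v = ∑' p : Σ r : ℕ, gammaSet 1 r 0, f p.2 :=
    (gammaSetDivGcdSigmaEquiv.symm.tsum_eq f).symm
  rw [e1, hS.tsum_sigma, zeta_eq_tsum_one_div_nat_cpow hs, tsum_mul_tsum_of_summable_norm hZ hC,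
    hM.tsum_prod]
  refine tsum_congr fun n => ?_
  rcases eq_or_ne n 0 with rfl | hn
  -- The class of gcd 0 is the zero vector, where f vanishes; it matches the n = 0 term of the zeta
  -- series, which is 0 by the convention `1 / 0 = 0`.
  · have hz : ((0 : ℕ) : ℂ) ^ s = 0 := by
      rw [Nat.cast_zero, Complex.zero_cpow hs0]
    simp only [hz, div_zero, zero_mul, tsum_zero]
    rw [← tsum_zero (α := ℂ) (β := gammaSet 1 0 0)]
    refine tsum_congr fun v => ?_
    have hv := gammaSet_eq_gcd_mul_divIntMap v.2
    rw [zero_smul] at hv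
    rw [hv, h0]
  · have : NeZero n := ⟨hn⟩
    have e2 := (gammaSetDivGcdEquiv n).tsum_eq (fun v => 1 / (n : ℂ) ^ s * f v)
    simp only [gammaSetDivGcdEquiv_eq] at e2
    rw [← e2]
    refine tsum_congr fun v => ?_
    rw [← hmul n hn]
    exact congrArg f (gammaSet_eq_gcd_mul_divIntMap v.2)

theorem tsum_latticeTerm_eq_zeta_mul (k : ℤ) (z : ℍ) {s : ℂ} (hs : 1 < s.re) :
    ∑' v : Fin 2 → ℤ, latticeTerm k s (v 0 * (z : ℂ) + v 1)
      = riemannZeta (2 * s) *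
        ∑' v : gammaSet 1 1 0, latticeTerm k s (v.1 0 * (z : ℂ) + v.1 1) := by
  have hs0 : s ≠ 0 := by
    rintro rfl
    rw [Complex.zero_re] at hs
    linarith
  refine tsum_fin_two_eq_zeta_mul (by simp; linarith) (summable_norm_latticeTerm k z hs) ?_ ?_
  · simp [latticeTerm_zero k hs0]
  · intro n hn v
    rw [← latticeTerm_nat_mul k s _ hn]
    congr 1
    simp only [Pi.smul_apply, nsmul_eq_mul]
    push_cast
    ring

theorem summable_latticeTerm_prod (k : ℤ) (z : ℍ) {s : ℂ} (hs : 1 < s.re) :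
    Summable fun p : ℤ × ℤ => latticeTerm k s (p.1 * (z : ℂ) + p.2) :=
  (finTwoArrowEquiv ℤ).summable_iff.1 (summable_norm_latticeTerm k z hs).of_norm

/-- The row c = 0 is 2 ζ(2s), and the rows c and -c agree because k is even. -/
theorem tsum_latticeTerm_eq_add {k : ℤ} (hk : Even k) (z : ℍ) {s : ℂ} (hs : 1 < s.re) :
    ∑' v : Fin 2 → ℤ, latticeTerm k s (v 0 * (z : ℂ) + v 1)
      = 2 * (riemannZeta (2 * s)
        + ∑' c : ℕ+, ∑' d : ℤ, latticeTerm k s (((c : ℕ) : ℂ) * (z : ℂ) + d)) := by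
  have hs0 : s ≠ 0 := by
    rintro rfl
    simp at hs
    linarith
  have hre : 1 < (2 * s).re := by simp; linarith
  have hP := summable_latticeTerm_prod k z hs
  have h1 : ∑' v : Fin 2 → ℤ, latticeTerm k s (v 0 * (z : ℂ) + v 1)
      = ∑' p : ℤ × ℤ, latticeTerm k s (p.1 * (z : ℂ) + p.2) :=
    (finTwoArrowEquiv ℤ).tsum_eq (fun p : ℤ × ℤ => latticeTerm k s (p.1 * (z : ℂ) + p.2))
  have heven : Function.Even fun c : ℤ => ∑' d : ℤ, latticeTerm k s (c * (z : ℂ) + d) := by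
    intro c
    simp only
    rw [← (Equiv.neg ℤ).tsum_eq]
    refine tsum_congr fun d => ?_
    rw [← latticeTerm_neg hk]
    congr 1
    simp
    ring
  have heven0 : Function.Even fun d : ℤ => latticeTerm k s d := by
    intro d
    simp only
    rw [← latticeTerm_neg hk]
    simp
  have hS0 : Summable fun d : ℤ => latticeTerm k s d := by
    simpa using hP.prod_factor 0
  have hz : ∑' d : ℤ, latticeTerm k s (((0 : ℤ) : ℂ) * (z : ℂ) + d) = 2 * riemannZeta (2 * s) := by
    simp only [Int.cast_zero, zero_mul, zero_add]
    rw [tsum_int_eq_zero_add_two_mul_tsum_pnat heven0 hS0, Int.cast_zero, latticeTerm_zero k hs0,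
      zero_add, nsmul_eq_mul, zeta_eq_tsum_one_div_nat_add_one_cpow hre]
    congr 1
    rw [tsum_pnat_eq_tsum_succ (f := fun n : ℕ => latticeTerm k s ((n : ℤ) : ℂ))]
    refine tsum_congr fun n => ?_
    rw [Int.cast_natCast, latticeTerm_natCast k s n.succ_ne_zero]
    push_cast
    rfl
  rw [h1, hP.tsum_prod, tsum_int_eq_zero_add_two_mul_tsum_pnat heven hP.prod, hz, nsmul_eq_mul,
    mul_add]
  simp

/-- The Eisenstein series in terms of the lattice sum. -/
theorem zeta_mul_eisenstein {k : ℤ} (hk : Even k) (z : ℍ) {s : ℂ} (hs : 1 < s.re) :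
    riemannZeta (2 * s) * eisenstein k z s
      = (z.im : ℂ) ^ s * (riemannZeta (2 * s)
        + ∑' c : ℕ+, ∑' d : ℤ, latticeTerm k s (((c : ℕ) : ℂ) * (z : ℂ) + d)) := by
  have h1 := tsum_latticeTerm_eq_add hk z hs
  rw [tsum_latticeTerm_eq_zeta_mul k z hs, tsum_gammaSet_latticeTerm hk z hs] at h1
  rw [eisenstein]
  simp only [eisensteinCosetTerm, eisensteinTerm_eq_latticeTerm]
  rw [tsum_mul_left]
  linear_combination ((z.im : ℂ) ^ s / 2) * h1

theorem summable_eisensteinCosetTerm (k : ℤ) (z : ℍ) {s : ℂ} (hs : 1 < s.re) :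
    Summable (eisensteinCosetTerm k z s) := by
  have := ((summable_latticeTerm_coset k z hs).of_norm).mul_left ((z.im : ℂ) ^ s)
  refine this.congr fun q => ?_
  rw [eisensteinCosetTerm, eisensteinTerm_eq_latticeTerm]

theorem norm_eisensteinCosetTerm (k : ℤ) (z : ℍ) (s : ℂ) (q : Cosets) :
    ‖eisensteinCosetTerm k z s q‖ = (q.out • z).im ^ s.re := by
  have hden : UpperHalfPlane.denom ((q.out : SL(2, ℤ)) : GL (Fin 2) ℝ) z = autFactor q.out z := by
    simp [UpperHalfPlane.denom, autFactor]
  have hj : ‖autFactor q.out z‖ ≠ 0 := by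
    rw [← hden, norm_ne_zero_iff]
    exact UpperHalfPlane.denom_ne_zero _ _
  rw [eisensteinCosetTerm, eisensteinTerm, norm_mul, norm_zpow, norm_div, Complex.norm_real,
    norm_norm, div_self hj, one_zpow, one_mul,
    Complex.norm_cpow_eq_rpow_re_of_pos (UpperHalfPlane.im_pos _)]

/-- Needed to carry the explicit formula from Re s > |κ| + 1 down to Re s > 1. On a strip each term
is bounded by the sum of its sizes on the two edges, whether Im γz is above or below 1. -/
theorem differentiableOn_eisenstein (k : ℤ) (z : ℍ) :
    DifferentiableOn ℂ (eisenstein k z) {s | 1 < s.re} := by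
  intro s₀ hs₀
  have hs₀ : 1 < s₀.re := hs₀
  set σ₁ := (1 + s₀.re) / 2 with hσ₁
  set σ₂ := s₀.re + 1 with hσ₂
  have hU : IsOpen {s : ℂ | σ₁ < s.re ∧ s.re < σ₂} :=
    (isOpen_lt continuous_const Complex.continuous_re).inter
      (isOpen_lt Complex.continuous_re continuous_const)
  have hmem : s₀ ∈ {s : ℂ | σ₁ < s.re ∧ s.re < σ₂} := ⟨by linarith, by linarith⟩
  have hsum : ∀ σ : ℝ, 1 < σ → Summable fun q : Cosets => (q.out • z).im ^ σ := by
    intro σ hσ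
    refine (summable_eisensteinCosetTerm k z (s := (σ : ℂ)) (by simpa using hσ)).norm.congr
      fun q => ?_
    rw [norm_eisensteinCosetTerm, Complex.ofReal_re]
  have hS := (hsum σ₁ (by linarith)).add (hsum σ₂ (by linarith))
  refine ((Complex.differentiableOn_tsum_of_summable_norm hS (fun q => ?_) hU
    (fun q s hs => ?_)).differentiableAt (hU.mem_nhds hmem)).differentiableWithinAt
  · have hpos : (((q.out • z).im : ℝ) : ℂ) ≠ 0 := by
      exact_mod_cast (UpperHalfPlane.im_pos (q.out • z)).ne'
    refine Differentiable.differentiableOn ?_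
    simp only [eisensteinCosetTerm, eisensteinTerm]
    exact (Differentiable.const_cpow differentiable_id (Or.inl hpos)).const_mul _
  · rw [norm_eisensteinCosetTerm]
    have hpos := UpperHalfPlane.im_pos (q.out • z)
    rcases le_total 1 (q.out • z).im with h1 | h1
    · exact le_add_of_nonneg_of_le (by positivity)
        (Real.rpow_le_rpow_of_exponent_le h1 hs.2.le)
    · exact le_add_of_le_of_nonneg (Real.rpow_le_rpow_of_exponent_ge hpos h1 hs.1.le)
        (by positivity)

end NonholoEisenstein

/-! ### The theta factor and the constant Fourier coefficient. -/

namespace NonholoEisenstein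
open MeasureTheory Set Filter Topology

noncomputable section

/-- The quotient of the rising factorial `(s)_p` by `s`. -/
def ascPochhammerDiv (p : ℕ) (s : ℂ) : ℂ :=
  if p = 0 then 1 / s else (ascPochhammer ℂ (p - 1)).eval (s + 1)

/-- The function `θ_k(s) = (s)_p Λ(2 s)`, `p = |k| / 2`, written without removable singularities
except at `s = 1 / 2`. -/
def thetaReg (p : ℕ) (s : ℂ) : ℂ :=
  (ascPochhammer ℂ p).eval s * completedRiemannZeta₀ (2 * s) - ascPochhammerDiv p s / 2
    - (ascPochhammer ℂ p).eval s / (1 - 2 * s)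

/-- The numerator of the singular part at `s = 1 / 2` of the constant Fourier coefficient. -/
def constSing (p : ℕ) (y : ℝ) (s : ℂ) : ℂ :=
  (ascPochhammer ℂ p).eval s * (y : ℂ) ^ s - (ascPochhammer ℂ p).eval (1 - s) * (y : ℂ) ^ (1 - s)

/-- The constant Fourier coefficient `θ_k(s) y ^ s + θ_k(1 - s) y ^ (1 - s)`, continued to
`s = 1 / 2`. -/
def constReg (p : ℕ) (y : ℝ) (s : ℂ) : ℂ :=
  ((ascPochhammer ℂ p).eval s * completedRiemannZeta₀ (2 * s) - ascPochhammerDiv p s / 2)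
      * (y : ℂ) ^ s
    + ((ascPochhammer ℂ p).eval (1 - s) * completedRiemannZeta₀ (2 * (1 - s))
      - ascPochhammerDiv p (1 - s) / 2) * (y : ℂ) ^ (1 - s)
    + 1 / 2 * dslope (constSing p y) (1 / 2) s

end

/-- For p ≥ 1 the factor s of (s)_p is cancelled in the definition, which removes the pole of Λ(2s)
at s = 0; only p = 0 keeps it. -/
theorem ascPochhammerDiv_eq (p : ℕ) {s : ℂ} (hs : s ≠ 0) :
    ascPochhammerDiv p s = (ascPochhammer ℂ p).eval s / s := by
  rcases p with _ | p
  · simp [ascPochhammerDiv]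
  · rw [ascPochhammerDiv, if_neg p.succ_ne_zero, Nat.add_sub_cancel, ascPochhammer_succ_left]
    field_simp
    simp

theorem differentiableAt_ascPochhammerDiv {p : ℕ} {s : ℂ} (hs : p = 0 → s ≠ 0) :
    DifferentiableAt ℂ (ascPochhammerDiv p) s := by
  unfold ascPochhammerDiv
  split_ifs with hp
  · exact (differentiableAt_const _).div differentiableAt_id (hs hp)
  · exact DifferentiableAt.comp (g := fun s => (ascPochhammer ℂ (p - 1)).eval s)
      (f := fun s : ℂ => s + 1) s (Polynomial.differentiable _).differentiableAt (by fun_prop)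

theorem thetaReg_eq {p : ℕ} {s : ℂ} (hs : s ≠ 0) :
    thetaReg p s = (ascPochhammer ℂ p).eval s * completedRiemannZeta (2 * s) := by
  rw [thetaReg, completedRiemannZeta_eq, ascPochhammerDiv_eq p hs]
  field_simp

theorem differentiableAt_thetaReg {p : ℕ} {s : ℂ} (hs : p = 0 → s ≠ 0) (hs' : s ≠ 1 / 2) :
    DifferentiableAt ℂ (thetaReg p) s := by
  have h1 : 1 - 2 * s ≠ 0 := by
    intro h
    apply hs'
    linear_combination (-1 / 2) * h
  have h2 : DifferentiableAt ℂ (fun s : ℂ => completedRiemannZeta₀ (2 * s)) s :=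
    (differentiable_completedZeta₀ _).comp s (by fun_prop)
  have h3 : DifferentiableAt ℂ (fun s : ℂ => (ascPochhammer ℂ p).eval s) s :=
    (Polynomial.differentiable _).differentiableAt
  exact ((h3.mul h2).sub ((differentiableAt_ascPochhammerDiv hs).div_const _)).sub
    (h3.div (by fun_prop) h1)

theorem ascPochhammer_eval_eq_Gamma_div (n : ℕ) {s : ℂ} (hs : Complex.Gamma s ≠ 0) :
    (ascPochhammer ℂ n).eval s = Complex.Gamma (s + n) / Complex.Gamma s := by
  rw [Complex.Gamma_add_nat_div_Gamma_eq]
  intro m hm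
  exact hs ((Complex.Gamma_eq_zero_iff s).2 ⟨m, hm⟩)

/-- Γ(w+p) = (w)_p Γ(w) and π^(-w) Γ(w) ζ(2w) = Λ(2w), as long as w is no pole of Γ. -/
theorem Gamma_mul_zeta_eq_thetaReg (p : ℕ) {w : ℂ} (hG : Complex.Gamma w ≠ 0) :
    (Real.pi : ℂ) ^ (-w) * Complex.Gamma (w + p) * riemannZeta (2 * w) = thetaReg p w := by
  have hw : w ≠ 0 := by
    rintro rfl
    simp at hG
  have hpi : (Real.pi : ℂ) ^ (-w) ≠ 0 := by
    rw [Complex.cpow_ne_zero_iff_of_exponent_ne_zero (by simpa using hw)]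
    exact_mod_cast Real.pi_ne_zero
  rw [thetaReg_eq hw, riemannZeta_def_of_ne_zero (by simpa using hw), Complex.Gammaℝ_def,
    ascPochhammer_eval_eq_Gamma_div p hG, show -(2 * w) / 2 = -w by ring,
    show 2 * w / 2 = w by ring]
  field_simp

/-- `Complex.Gamma` has the default value 0 exactly at its poles, which are the isolated zeros of
the entire function 1/Γ. The limit defining `thetaK` thus meets only regular points. -/
theorem eventually_Gamma_ne_zero (s : ℂ) : ∀ᶠ w in 𝓝[≠] s, Complex.Gamma w ≠ 0 := by
  by_contra h
  have h1 : ∃ᶠ w in 𝓝[≠] s, (Complex.Gamma w)⁻¹ = 0 := by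
    refine (Filter.not_eventually.1 h).mono fun w hw => ?_
    simpa using hw
  have h2 := (AnalyticOnNhd.eq_of_frequently_eq
    (fun w _ => Complex.differentiable_one_div_Gamma.analyticAt w)
    (fun w _ => analyticAt_const) h1 : (fun w => (Complex.Gamma w)⁻¹) = fun _ => (0 : ℂ))
  have := congrFun h2 1
  simp at this

theorem thetaK_eq_thetaReg (k : ℤ) {s : ℂ} (hs : k.natAbs / 2 = 0 → s ≠ 0) (hs' : s ≠ 1 / 2) :
    thetaK k s = thetaReg (k.natAbs / 2) s := by
  refine Tendsto.limUnder_eq ?_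
  have h1 : Tendsto (thetaReg (k.natAbs / 2)) (𝓝[≠] s) (𝓝 (thetaReg (k.natAbs / 2) s)) :=
    (differentiableAt_thetaReg hs hs').continuousAt.tendsto.mono_left nhdsWithin_le_nhds
  refine h1.congr' ?_
  filter_upwards [eventually_Gamma_ne_zero s] with w hw
  exact (Gamma_mul_zeta_eq_thetaReg _ hw).symm

theorem differentiable_constSing (p : ℕ) {y : ℝ} (hy : 0 < y) :
    Differentiable ℂ (constSing p y) := by
  have hy0 : (y : ℂ) ≠ 0 := by exact_mod_cast hy.ne'
  refine Differentiable.sub (Differentiable.mul ?_ ?_) (Differentiable.mul ?_ ?_)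
  · exact Polynomial.differentiable _
  · exact Differentiable.const_cpow differentiable_id (Or.inl hy0)
  · exact (Polynomial.differentiable (ascPochhammer ℂ p)).comp (by fun_prop)
  · exact Differentiable.const_cpow (by fun_prop) (Or.inl hy0)

theorem differentiableAt_constReg {p : ℕ} {y : ℝ} (hy : 0 < y) {s : ℂ}
    (hs : p = 0 → s ≠ 0 ∧ s ≠ 1) : DifferentiableAt ℂ (constReg p y) s := by
  have hy0 : (y : ℂ) ≠ 0 := by exact_mod_cast hy.ne'
  have hz : Differentiable ℂ (fun s : ℂ => completedRiemannZeta₀ (2 * s)) :=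
    differentiable_completedZeta₀.comp (by fun_prop)
  have hP : Differentiable ℂ (fun s : ℂ => (ascPochhammer ℂ p).eval s) := Polynomial.differentiable _
  have hsub : Differentiable ℂ (fun s : ℂ => 1 - s) := by fun_prop
  have h1 : DifferentiableAt ℂ (ascPochhammerDiv p) (1 - s) :=
    differentiableAt_ascPochhammerDiv fun hp h => (hs hp).2 (by linear_combination -h)
  have h2 : DifferentiableAt ℂ (fun s => ascPochhammerDiv p (1 - s)) s :=
    h1.comp s hsub.differentiableAt
  have h3 := differentiableAt_ascPochhammerDiv (p := p) (s := s) fun hp => (hs hp).1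
  have h4 : DifferentiableAt ℂ (dslope (constSing p y) (1 / 2)) s :=
    ((Complex.differentiableOn_dslope univ_mem).2
      (differentiable_constSing p hy).differentiableOn).differentiableAt univ_mem
  have e1 : Differentiable ℂ (fun s : ℂ => (y : ℂ) ^ s) :=
    Differentiable.const_cpow differentiable_id (Or.inl hy0)
  unfold constReg
  exact ((((hP.mul hz).differentiableAt.sub (h3.div_const _)).mul e1.differentiableAt).add
    ((((hP.comp hsub).mul (hz.comp hsub)).differentiableAt.sub (h2.div_const _)).mul
      (e1.comp hsub).differentiableAt)).add (h4.const_mul _)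

/-- The poles of the two theta terms at s = 1/2 cancel: their singular parts add up to `constSing`
divided by 2(s - 1/2), and `constSing` vanishes at 1/2. -/
theorem constReg_eq (p : ℕ) (y : ℝ) {s : ℂ} (hs : s ≠ 1 / 2) :
    constReg p y s = thetaReg p s * (y : ℂ) ^ s + thetaReg p (1 - s) * (y : ℂ) ^ (1 - s) := by
  have h1 : 1 - 2 * s ≠ 0 := by
    intro h
    apply hs
    linear_combination (-1 / 2) * h
  have h2 : 1 - 2 * (1 - s) = -(1 - 2 * s) := by ring
  have h3 : s - 1 / 2 = -(1 - 2 * s) / 2 := by ring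
  have h0 : constSing p y (1 / 2) = 0 := by
    rw [constSing, show (1 : ℂ) - 1 / 2 = 1 / 2 by norm_num, sub_self]
  rw [constReg, thetaReg, thetaReg, dslope_of_ne _ hs, slope_def_field, h0, sub_zero, constSing,
    h2, h3]
  field_simp
  ring

theorem ascPochhammer_eval_one_sub (p : ℕ) {s : ℂ} (hs : p < s.re) :
    (ascPochhammer ℂ p).eval (1 - s)
      = (-1) ^ p * (Complex.Gamma s / Complex.Gamma (s - p)) := by
  have h : Complex.Gamma (s - p) ≠ 0 := Complex.Gamma_ne_zero_of_re_pos (by simpa using hs)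
  rw [show 1 - s = -(s - 1) by ring, ascPochhammer_eval_neg_eq_descPochhammer,
    descPochhammer_eval_eq_ascPochhammer, show s - 1 - p + 1 = s - p by ring,
    ascPochhammer_eval_eq_Gamma_div p h, sub_add_cancel]

/-- The functional equation in the form needed for the constant Fourier coefficient. -/
theorem thetaReg_one_sub (p : ℕ) {s : ℂ} (hs : (p : ℝ) + 1 < s.re) :
    thetaReg p (1 - s) = (4 * Real.pi : ℂ) ^ (1 - s) * (-1) ^ p *
      (Complex.Gamma (2 * s - 1) * riemannZeta (2 * s - 1) / Complex.Gamma (s - p)) := by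
  have hp : (0 : ℝ) ≤ p := p.cast_nonneg
  have hpi : (Real.pi : ℂ) ≠ 0 := by exact_mod_cast Real.pi_ne_zero
  have hne : ∀ x : ℂ, x.re ≠ s.re → s - x ≠ 0 := by
    intro x hx h
    exact hx (by rw [sub_eq_zero.1 h])
  have h1 : (1 : ℂ) - s ≠ 0 := by
    rw [← neg_ne_zero, neg_sub]
    exact hne 1 (by simp; linarith)
  have h2 : 2 * s - 1 ≠ 0 := by
    have := hne (1 / 2) (by norm_num; linarith)
    intro h
    apply this
    linear_combination (1 / 2) * h
  have hG1 : Complex.Gammaℝ (2 * s - 1) ≠ 0 :=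
    Complex.Gammaℝ_ne_zero_of_re_pos (by simp; linarith)
  have hΛ : completedRiemannZeta (2 * (1 - s))
      = riemannZeta (2 * s - 1) * ((Real.pi : ℂ) ^ (1 / 2 - s) * Complex.Gamma (s - 1 / 2)) := by
    rw [show 2 * (1 - s) = 1 - (2 * s - 1) by ring, completedRiemannZeta_one_sub,
      riemannZeta_def_of_ne_zero h2]
    have : Complex.Gammaℝ (2 * s - 1) = (Real.pi : ℂ) ^ (1 / 2 - s) * Complex.Gamma (s - 1 / 2) := by
      rw [Complex.Gammaℝ_def]
      ring_nf
    rw [← this]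
    field_simp
  -- Duplication merges Γ(s - 1/2), from the functional equation, and Γ(s), from the Pochhammer
  -- factor, into Γ(2s - 1).
  have hdup := Complex.Gamma_mul_Gamma_add_half (s - 1 / 2)
  rw [sub_add_cancel, show 2 * (s - 1 / 2) = 2 * s - 1 by ring,
    show 1 - (2 * s - 1) = 2 * (1 - s) by ring] at hdup
  have h4 : (4 * Real.pi : ℂ) ^ (1 - s) = (2 : ℂ) ^ (2 * (1 - s)) * (Real.pi : ℂ) ^ (1 - s) := by
    have e4 : (4 * Real.pi : ℂ) = ((4 : ℝ) : ℂ) * ((Real.pi : ℝ) : ℂ) := by push_cast; rfl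
    rw [e4, Complex.mul_cpow_ofReal_nonneg (by norm_num) Real.pi_pos.le, two_mul,
      Complex.cpow_add _ _ two_ne_zero]
    congr 1
    rw [show ((4 : ℝ) : ℂ) = ((2 : ℝ) : ℂ) * ((2 : ℝ) : ℂ) by push_cast; norm_num,
      Complex.mul_cpow_ofReal_nonneg (by norm_num) (by norm_num)]
    simp
  have h5 : (Real.pi : ℂ) ^ (1 - s) = ((√Real.pi : ℝ) : ℂ) * (Real.pi : ℂ) ^ (1 / 2 - s) := by
    rw [Real.sqrt_eq_rpow, Complex.ofReal_cpow Real.pi_pos.le,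
      ← Complex.cpow_add _ _ hpi]
    congr 1
    push_cast
    ring
  rw [thetaReg_eq h1, ascPochhammer_eval_one_sub p (by linarith), hΛ, h4, h5]
  linear_combination ((-1) ^ p * riemannZeta (2 * s - 1) * (Real.pi : ℂ) ^ (1 / 2 - s) /
    Complex.Gamma (s - p)) * hdup

end NonholoEisenstein

/-! ### The nonconstant Fourier terms. -/

namespace NonholoEisenstein
open MeasureTheory Set Filter Topology

noncomputable section

/-- The sum over `c, m ≥ 1` of the Whittaker terms at `c Z`. -/
def whittakerSum (κ : ℤ) (Z s : ℂ) : ℂ :=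
  ∑' p : ℕ+ × ℕ+, whittakerTerm κ s ((p.1 : ℕ) * Z) p.2

/-- The quotient `Γ(s + |κ|) / Γ(s + κ)` as a polynomial. -/
def gammaQuot (κ : ℤ) (s : ℂ) : ℂ := (ascPochhammer ℂ (|κ| - κ).toNat).eval (s + κ)

/-- The part of `θ_k(s) E_k(z, s)` without the constant Fourier coefficient. -/
def nonconstReg (κ : ℤ) (z : ℍ) (s : ℂ) : ℂ :=
  (4 * Real.pi * z.im : ℂ) ^ s * (-1) ^ κ *
    (gammaQuot κ s * whittakerSum κ z s
      + gammaQuot (-κ) s * whittakerSum (-κ) (-(starRingEnd ℂ) (z : ℂ)) s)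

end

theorem summable_one_div_sq_prod (C : ℝ) :
    Summable fun p : ℕ+ × ℕ+ => C * ((1 / ((p.1 : ℕ) : ℝ) ^ 2) * (1 / ((p.2 : ℕ) : ℝ) ^ 2)) := by
  have h : Summable fun n : ℕ+ => 1 / ((n : ℕ) : ℝ) ^ 2 :=
    (Real.summable_one_div_nat_pow.2 one_lt_two).comp_injective PNat.coe_injective
  exact (h.mul_of_nonneg h (fun _ => by positivity) (fun _ => by positivity)).mul_left C

/-- A majorant uniform in bounded s, for the Weierstrass test: the exponential has size exp(-Y
mc/2), and the other factors grow polynomially in mc. -/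
theorem exists_norm_whittakerTerm_le (κ : ℤ) {Z : ℂ} (hZ : 0 < Z.im) (R : ℝ) :
    ∃ C : ℝ, ∀ s : ℂ, ‖s‖ ≤ R → ∀ p : ℕ+ × ℕ+, ‖whittakerTerm κ s ((p.1 : ℕ) * Z) p.2‖
      ≤ C * ((1 / ((p.1 : ℕ) : ℝ) ^ 2) * (1 / ((p.2 : ℕ) : ℝ) ^ 2)) := by
  have hpi := Real.pi_pos
  set Y := 4 * Real.pi * Z.im with hY
  have hY0 : 0 < Y := by positivity
  obtain ⟨C, n, hC, hT⟩ := exists_norm_tricomi_le (R + (|(κ : ℝ)| + 1)) hY0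
  obtain ⟨N, hN⟩ := exists_nat_ge (2 * R)
  -- N bounds m^(2s-1), n bounds `tricomi`, and 2 leaves room for 1/(mc)².
  obtain ⟨D, hD, hE⟩ := one_add_pow_le_exp (N + 2 + n) (half_pos hY0)
  refine ⟨C * (1 + Y) ^ n * D, fun s hs p => ?_⟩
  obtain ⟨c, m⟩ := p
  have hc : (1 : ℝ) ≤ (c : ℕ) := by exact_mod_cast c.pos
  have hm : (1 : ℝ) ≤ (m : ℕ) := by exact_mod_cast m.pos
  simp only
  set c' : ℝ := ((c : ℕ) : ℝ) with hc'
  set m' : ℝ := ((m : ℕ) : ℝ) with hm'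
  have hmc : 1 ≤ m' * c' := one_le_mul_of_one_le_of_one_le hm hc
  have hmc0 : 0 ≤ m' * c' := by linarith
  have e1 : ‖Complex.exp (2 * Real.pi * Complex.I * ((c : ℕ) * Z) * (m : ℕ))‖
      = Real.exp (-(Y / 2 * (m' * c'))) := by
    rw [Complex.norm_exp]
    congr 1
    simp [hY, hc', hm']
    ring
  have e2 : ‖((m : ℕ) : ℂ) ^ (2 * s - 1)‖ ≤ (1 + m' * c') ^ N := by
    have h1 : ‖((m : ℕ) : ℂ) ^ (2 * s - 1)‖ = m' ^ (2 * s.re - 1) := by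
      have h := Complex.norm_cpow_eq_rpow_re_of_pos (x := m') (by linarith) (2 * s - 1)
      rw [hm', Complex.ofReal_natCast] at h
      rw [h]
      simp [hm']
    have h2 := Complex.re_le_norm s
    rw [h1, ← Real.rpow_natCast]
    calc _ ≤ m' ^ (N : ℝ) := Real.rpow_le_rpow_of_exponent_le hm (by linarith)
      _ ≤ _ := Real.rpow_le_rpow (by linarith) (by nlinarith) (by positivity)
  have e3 : ‖tricomi (s - κ) (s + κ - 1) (4 * Real.pi * (m : ℕ) * ((c : ℕ) * Z : ℂ).im)‖
      ≤ C * ((1 + Y) ^ n * (1 + m' * c') ^ n) := by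
    have h0 : 4 * Real.pi * ((m : ℕ) : ℝ) * ((c : ℕ) * Z : ℂ).im = Y * (m' * c') := by
      simp [hY, hc', hm']
      ring
    rw [h0]
    refine (hT _ _ _ ?_ ?_ (le_mul_of_one_le_right hY0.le hmc)).trans ?_
    · refine (norm_sub_le _ _).trans ?_
      rw [Complex.norm_intCast]
      linarith
    · refine (norm_sub_le _ _).trans ?_
      have := norm_add_le s (κ : ℂ)
      rw [Complex.norm_intCast] at this
      rw [norm_one]
      linarith
    · rw [← mul_pow]
      gcongr
      nlinarith
  have hpos : 0 < m' * c' := by linarith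
  rw [whittakerTerm, norm_mul, norm_mul, e1]
  have e4 : (m' * c') ^ 2 * ((1 + m' * c') ^ N * (1 + m' * c') ^ n) * Real.exp (-(Y / 2 * (m' * c')))
      ≤ D := by
    calc _ ≤ (1 + m' * c') ^ 2 * ((1 + m' * c') ^ N * (1 + m' * c') ^ n)
          * Real.exp (-(Y / 2 * (m' * c'))) := by gcongr; linarith
      _ = (1 + m' * c') ^ (N + 2 + n) * Real.exp (-(Y / 2 * (m' * c'))) := by ring
      _ ≤ D * Real.exp (Y / 2 * (m' * c')) * Real.exp (-(Y / 2 * (m' * c'))) := by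
          gcongr
          exact hE _ hmc0
      _ = D := by rw [mul_assoc, ← Real.exp_add, add_neg_cancel, Real.exp_zero, mul_one]
  have e5 : (1 / c' ^ 2) * (1 / m' ^ 2) = 1 / (m' * c') ^ 2 := by
    rw [mul_pow]
    field_simp
  rw [e5]
  calc _ ≤ Real.exp (-(Y / 2 * (m' * c'))) * (1 + m' * c') ^ N *
        (C * ((1 + Y) ^ n * (1 + m' * c') ^ n)) := by gcongr
    _ = C * (1 + Y) ^ n * ((m' * c') ^ 2 * ((1 + m' * c') ^ N * (1 + m' * c') ^ n) *
        Real.exp (-(Y / 2 * (m' * c')))) * (1 / (m' * c') ^ 2) := by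
        field_simp
    _ ≤ C * (1 + Y) ^ n * D * (1 / (m' * c') ^ 2) := by gcongr

theorem summable_whittakerTerm (κ : ℤ) {Z : ℂ} (hZ : 0 < Z.im) (s : ℂ) :
    Summable fun p : ℕ+ × ℕ+ => whittakerTerm κ s ((p.1 : ℕ) * Z) p.2 := by
  obtain ⟨C, h⟩ := exists_norm_whittakerTerm_le κ hZ ‖s‖
  exact (summable_one_div_sq_prod C).of_norm_bounded (h s le_rfl)

theorem differentiable_whittakerTerm (κ : ℤ) {τ : ℂ} (hτ : 0 < τ.im) (m : ℕ+) :
    Differentiable ℂ fun s => whittakerTerm κ s τ m := by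
  have hm : (((m : ℕ) : ℂ)) ≠ 0 := by exact_mod_cast m.ne_zero
  have hm' : (0 : ℝ) < (m : ℕ) := by exact_mod_cast m.pos
  have hx : 0 < 4 * Real.pi * (m : ℕ) * τ.im := by have := Real.pi_pos; positivity
  have h := differentiable_tricomi (-κ) (κ - 1) hx
  simp only [← add_sub_assoc, ← sub_eq_add_neg] at h
  exact ((Differentiable.const_cpow (by fun_prop) (Or.inl hm)).const_mul _).mul h

theorem differentiable_whittakerSum (κ : ℤ) {Z : ℂ} (hZ : 0 < Z.im) :
    Differentiable ℂ (whittakerSum κ Z) := by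
  intro s₀
  obtain ⟨C, h⟩ := exists_norm_whittakerTerm_le κ hZ (‖s₀‖ + 1)
  refine (Complex.differentiableOn_tsum_of_summable_norm (summable_one_div_sq_prod C)
    (U := Metric.ball 0 (‖s₀‖ + 1)) (fun p => ?_) Metric.isOpen_ball (fun p s hs => ?_)).differentiableAt
    (Metric.isOpen_ball.mem_nhds (by simp))
  · refine (differentiable_whittakerTerm κ ?_ p.2).differentiableOn
    have hp : (0 : ℝ) < (p.1 : ℕ) := by exact_mod_cast p.1.pos
    simp only [Complex.mul_im, Complex.natCast_re, Complex.natCast_im, zero_mul, add_zero]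
    positivity
  · refine h s ?_ p
    have := mem_ball_zero_iff.1 hs
    exact this.le

theorem differentiable_nonconstReg (κ : ℤ) (z : ℍ) : Differentiable ℂ (nonconstReg κ z) := by
  have hz := z.im_pos
  have hy : (4 * Real.pi * z.im : ℂ) ≠ 0 := by
    have h : 4 * Real.pi * z.im ≠ 0 := by have := Real.pi_pos; positivity
    exact_mod_cast h
  have hQ : ∀ κ : ℤ, Differentiable ℂ (gammaQuot κ) := fun κ =>
    Differentiable.comp (g := fun s => (ascPochhammer ℂ (|κ| - κ).toNat).eval s)
      (f := fun s : ℂ => s + κ) (Polynomial.differentiable _) (by fun_prop)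
  have h1 := differentiable_whittakerSum κ (Z := z) hz
  have h2 := differentiable_whittakerSum (-κ) (Z := -(starRingEnd ℂ) (z : ℂ)) (by simpa using hz)
  exact ((Differentiable.const_cpow differentiable_id (Or.inl hy)).mul_const _).mul
    (((hQ κ).mul h1).add ((hQ (-κ)).mul h2))

theorem Gamma_add_abs_eq {κ : ℤ} {s : ℂ} (hs : |(κ : ℝ)| < s.re) :
    Complex.Gamma (s + (κ.natAbs : ℕ)) = gammaQuot κ s * Complex.Gamma (s + κ) := by
  have h1 := neg_abs_le (κ : ℝ)
  have hG : Complex.Gamma (s + κ) ≠ 0 := Complex.Gamma_ne_zero_of_re_pos (by simp; linarith)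
  rw [gammaQuot, ascPochhammer_eval_eq_Gamma_div _ hG, div_mul_cancel₀ _ hG]
  congr 1
  have h2 : ((|κ| - κ).toNat : ℤ) = (κ.natAbs : ℤ) - κ := by
    rw [Int.toNat_of_nonneg (by linarith [le_abs_self κ]), Int.abs_eq_natAbs]
  have h3 : (((|κ| - κ).toNat : ℕ) : ℂ) = (κ.natAbs : ℂ) - κ := by
    rw [← Int.cast_natCast, h2, Int.cast_sub, Int.cast_natCast]
  rw [h3]
  ring

theorem Gamma_add_mul_Gamma_sub (κ : ℤ) (s : ℂ) :
    Complex.Gamma (s + κ) * Complex.Gamma (s - κ)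
      = Complex.Gamma (s + (κ.natAbs : ℕ)) * Complex.Gamma (s - (κ.natAbs : ℕ)) := by
  rcases Int.natAbs_eq κ with h | h
  · have : (κ : ℂ) = (κ.natAbs : ℂ) := by
      conv_lhs => rw [h]
      simp
    rw [this]
  · have : (κ : ℂ) = -(κ.natAbs : ℂ) := by
      conv_lhs => rw [h]
      simp
    rw [this, sub_neg_eq_add, mul_comm, sub_eq_add_neg]

theorem neg_one_pow_natAbs (κ : ℤ) : ((-1 : ℂ)) ^ κ.natAbs = (-1) ^ κ := by
  obtain ⟨n, rfl | rfl⟩ := κ.eq_nat_or_neg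
  · simp
  · rw [Int.natAbs_neg, Int.natAbs_natCast, zpow_neg, zpow_natCast, ← inv_pow, inv_neg, inv_one]

theorem mul_eq_of_mul_mul_eq {g₁ g₂ T e L A W W' : ℂ} (h₁ : g₁ ≠ 0) (h₂ : g₂ ≠ 0) (he : e * e = 1)
    (h : g₁ * g₂ * T * e * L = A + g₂ * W + g₁ * W') :
    T * L = e * (A / (g₁ * g₂) + W / g₁ + W' / g₂) := by
  field_simp
  linear_combination e * h - T * L * g₁ * g₂ * he

/-- The contribution of a fixed `c ≥ 1` to the Eisenstein series. -/
theorem completed_tsum_latticeTerm {κ : ℤ} (z : ℍ) {s : ℂ} (hs : |(κ : ℝ)| + 1 < s.re) (c : ℕ+) :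
    (Real.pi : ℂ) ^ (-s) * Complex.Gamma (s + (κ.natAbs : ℕ)) * (z.im : ℂ) ^ s *
        ∑' d : ℤ, latticeTerm (2 * κ) s (((c : ℕ) : ℂ) * (z : ℂ) + d)
      = (4 * Real.pi * z.im : ℂ) ^ (1 - s) * (-1) ^ κ *
          (Complex.Gamma (2 * s - 1) / Complex.Gamma (s - (κ.natAbs : ℕ))) *
            (1 / ((c : ℕ) : ℂ) ^ (2 * s - 1))
        + (4 * Real.pi * z.im : ℂ) ^ s * (-1) ^ κ *
          (gammaQuot κ s * ∑' m : ℕ+, whittakerTerm κ s ((c : ℕ) * (z : ℂ)) m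
            + gammaQuot (-κ) s * ∑' m : ℕ+, whittakerTerm (-κ) s
              ((c : ℕ) * (-(starRingEnd ℂ) (z : ℂ))) m) := by
  have hz := z.im_pos
  have hpi := Real.pi_pos
  have habs := abs_nonneg (κ : ℝ)
  have hc : (0 : ℝ) < (c : ℕ) := by exact_mod_cast c.pos
  have hc0 : ((c : ℕ) : ℂ) ≠ 0 := by exact_mod_cast c.ne_zero
  obtain ⟨hα, hβ⟩ := two_lt_re_add_int hs
  have hG1 : Complex.Gamma (s + κ) ≠ 0 := Complex.Gamma_ne_zero_of_re_pos (by linarith)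
  have hG2 : Complex.Gamma (s - κ) ≠ 0 := Complex.Gamma_ne_zero_of_re_pos (by linarith)
  have hτ : 0 < (((c : ℕ) : ℂ) * (z : ℂ)).im := by
    simp only [Complex.mul_im, Complex.natCast_re, Complex.natCast_im, zero_mul, add_zero]
    exact mul_pos hc hz
  have hsum : Summable fun n : ℤ => latticeTerm (2 * κ) s (((c : ℕ) : ℂ) * (z : ℂ) + n) := by
    have := (summable_latticeTerm_prod (2 * κ) z (s := s) (by linarith)).prod_factor ((c : ℕ) : ℤ)
    simpa using this
  have hP := tsum_latticeTerm_add_int hs hτ hsum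
  have hconj : -(starRingEnd ℂ) (((c : ℕ) : ℂ) * (z : ℂ))
      = ((c : ℕ) : ℂ) * (-(starRingEnd ℂ) (z : ℂ)) := by
    rw [map_mul, Complex.conj_natCast]
    ring
  rw [hconj] at hP
  have him : ((((c : ℕ) : ℂ) * (z : ℂ)).im : ℂ) = ((c : ℕ) : ℂ) * z.im := by
    simp
  rw [him] at hP
  have hQ1 := Gamma_add_abs_eq (κ := κ) (s := s) (by linarith)
  have hQ2 := Gamma_add_abs_eq (κ := -κ) (s := s) (by push_cast; rw [abs_neg]; linarith)
  rw [Int.natAbs_neg, Int.cast_neg, ← sub_eq_add_neg] at hQ2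
  have hGG := Gamma_add_mul_Gamma_sub κ s
  set L := ∑' d : ℤ, latticeTerm (2 * κ) s (((c : ℕ) : ℂ) * (z : ℂ) + d)
  set W := ∑' m : ℕ+, whittakerTerm κ s ((c : ℕ) * (z : ℂ)) m
  set W' := ∑' m : ℕ+, whittakerTerm (-κ) s ((c : ℕ) * (-(starRingEnd ℂ) (z : ℂ))) m
  have hsq : ((-1 : ℂ) ^ κ) * (-1) ^ κ = 1 := by
    rw [← mul_zpow]
    norm_num
  have hy0 : (0 : ℝ) ≤ 4 * Real.pi * z.im := by positivity
  have hY : (4 * Real.pi * z.im : ℂ) = ((4 * Real.pi * z.im : ℝ) : ℂ) := by push_cast; rfl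
  have e1 : (4 * Real.pi * (((c : ℕ) : ℂ) * z.im)) ^ (1 - 2 * s)
      = (4 * Real.pi * z.im : ℂ) ^ (1 - 2 * s) * (1 / ((c : ℕ) : ℂ) ^ (2 * s - 1)) := by
    rw [show (4 * Real.pi * (((c : ℕ) : ℂ) * z.im))
        = ((4 * Real.pi * z.im : ℝ) : ℂ) * (((c : ℕ) : ℝ) : ℂ) by push_cast; ring,
      Complex.mul_cpow_ofReal_nonneg hy0 hc.le, hY, Complex.ofReal_natCast, one_div,
      ← Complex.cpow_neg, neg_sub]
  have hY0 : (4 * Real.pi * z.im : ℂ) ≠ 0 := by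
    rw [hY]
    exact_mod_cast (by positivity : 4 * Real.pi * z.im ≠ 0)
  have e2 : (4 * Real.pi * z.im : ℂ) ^ (1 - s)
      = (4 * Real.pi * z.im : ℂ) ^ s * (4 * Real.pi * z.im : ℂ) ^ (1 - 2 * s) := by
    rw [← Complex.cpow_add _ _ hY0]
    ring_nf
  have h2pi : (2 * Real.pi : ℂ) = ((2 * Real.pi : ℝ) : ℂ) := by push_cast; rfl
  have h2pi0 : (2 * Real.pi : ℂ) ≠ 0 := by
    rw [h2pi]
    exact_mod_cast (by positivity : 2 * Real.pi ≠ 0)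
  -- Trades the normalisation π^(-s) y^s for the (4πy)^s that fits the argument of `tricomi`.
  have e3 : (4 * Real.pi * z.im : ℂ) ^ s * (2 * Real.pi : ℂ) ^ (-(2 * s))
      = (Real.pi : ℂ) ^ (-s) * (z.im : ℂ) ^ s := by
    have hpi0 : (Real.pi : ℂ) ≠ 0 := by exact_mod_cast hpi.ne'
    have h4 : (4 * Real.pi * z.im : ℂ) ^ s
        = (2 * Real.pi : ℂ) ^ s * ((2 * Real.pi : ℂ) ^ s * ((Real.pi : ℂ) ^ (-s) * (z.im : ℂ) ^ s)) := by
      have h5 : (2 * Real.pi : ℂ) ^ s = (2 : ℂ) ^ s * (Real.pi : ℂ) ^ s := by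
        have := Complex.mul_cpow_ofReal_nonneg zero_le_two hpi.le s
        simpa using this
      have h6 : (4 * Real.pi * z.im : ℂ) ^ s = (2 * Real.pi : ℂ) ^ s * ((2 : ℂ) ^ s * (z.im : ℂ) ^ s) := by
        have h7 := Complex.mul_cpow_ofReal_nonneg zero_le_two hz.le s
        have h8 := Complex.mul_cpow_ofReal_nonneg (a := 2 * Real.pi) (b := 2 * z.im)
          (by positivity) (by positivity) s
        push_cast at h7 h8
        rw [← h7, ← h8]
        ring_nf
      have h9 : (Real.pi : ℂ) ^ s * (Real.pi : ℂ) ^ (-s) = 1 := by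
        rw [← Complex.cpow_add _ _ hpi0, add_neg_cancel, Complex.cpow_zero]
      rw [h6, h5]
      linear_combination (-(2 : ℂ) ^ s * (Real.pi : ℂ) ^ s * (2 : ℂ) ^ s * (z.im : ℂ) ^ s) * h9
    have h10 : (2 * Real.pi : ℂ) ^ s * (2 * Real.pi : ℂ) ^ s * (2 * Real.pi : ℂ) ^ (-(2 * s)) = 1 := by
      rw [← Complex.cpow_add _ _ h2pi0, ← Complex.cpow_add _ _ h2pi0,
        show s + s + -(2 * s) = 0 by ring, Complex.cpow_zero]
    rw [h4]
    linear_combination ((Real.pi : ℂ) ^ (-s) * (z.im : ℂ) ^ s) * h10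
  rw [e1] at hP
  have hG3 : Complex.Gamma (s + (κ.natAbs : ℕ)) ≠ 0 := by
    refine Complex.Gamma_ne_zero_of_re_pos ?_
    have : (0 : ℝ) ≤ (κ.natAbs : ℕ) := Nat.cast_nonneg _
    simp only [Complex.add_re, Complex.natCast_re]
    linarith
  have hG4 : Complex.Gamma (s - (κ.natAbs : ℕ)) ≠ 0 := by
    intro h
    rw [h, mul_zero] at hGG
    exact mul_ne_zero hG1 hG2 hGG
  have hL : (2 * Real.pi : ℂ) ^ (-(2 * s)) * L
      = (-1) ^ κ * ((4 * Real.pi * z.im : ℂ) ^ (1 - 2 * s) * (1 / ((c : ℕ) : ℂ) ^ (2 * s - 1)) *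
        Complex.Gamma (2 * s - 1) / (Complex.Gamma (s + κ) * Complex.Gamma (s - κ))
        + W / Complex.Gamma (s + κ) + W' / Complex.Gamma (s - κ)) :=
    mul_eq_of_mul_mul_eq hG1 hG2 hsq hP
  have hstep : (Real.pi : ℂ) ^ (-s) * Complex.Gamma (s + (κ.natAbs : ℕ)) * (z.im : ℂ) ^ s * L
      = Complex.Gamma (s + (κ.natAbs : ℕ)) * (4 * Real.pi * z.im : ℂ) ^ s *
        ((2 * Real.pi : ℂ) ^ (-(2 * s)) * L) := by
    linear_combination (-Complex.Gamma (s + (κ.natAbs : ℕ)) * L) * e3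
  rw [hstep, hL, e2, hGG]
  have hd1 : Complex.Gamma (s + (κ.natAbs : ℕ)) * (W / Complex.Gamma (s + κ))
      = gammaQuot κ s * W := by
    rw [hQ1]
    field_simp
  have hd2 : Complex.Gamma (s + (κ.natAbs : ℕ)) * (W' / Complex.Gamma (s - κ))
      = gammaQuot (-κ) s * W' := by
    rw [hQ2]
    field_simp
  have hd3 : ∀ X : ℂ, Complex.Gamma (s + (κ.natAbs : ℕ)) * (X /
      (Complex.Gamma (s + (κ.natAbs : ℕ)) * Complex.Gamma (s - (κ.natAbs : ℕ))))
      = X / Complex.Gamma (s - (κ.natAbs : ℕ)) := by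
    intro X
    field_simp
  linear_combination ((4 * Real.pi * z.im : ℂ) ^ s * (-1) ^ κ) * (hd1 + hd2 +
    hd3 ((4 * Real.pi * z.im : ℂ) ^ (1 - 2 * s) * (1 / ((c : ℕ) : ℂ) ^ (2 * s - 1)) *
        Complex.Gamma (2 * s - 1)))

end NonholoEisenstein

/-! ### The analytic continuation. -/

namespace NonholoEisenstein
open MeasureTheory Set Filter Topology

theorem natAbs_two_mul_div_two (κ : ℤ) : (2 * κ).natAbs / 2 = κ.natAbs := by omega

/-- Summed over c, the zero modes give ζ(2s-1), which `thetaReg_one_sub` turns into the second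
constant term. The bound on Re s ensures Re(s ± κ) > 1, as the kernels need. -/
theorem thetaK_mul_eisenstein {κ : ℤ} (z : ℍ) {s : ℂ} (hs : |(κ : ℝ)| + 1 < s.re) :
    thetaReg κ.natAbs s * eisenstein (2 * κ) z s
      = constReg κ.natAbs z.im s + nonconstReg κ z s := by
  have hz := z.im_pos
  have hz' : 0 < (-(starRingEnd ℂ) (z : ℂ)).im := by simpa using hz
  have hpi := Real.pi_pos
  have habs := abs_nonneg (κ : ℝ)
  have hre : 1 < (2 * s - 1).re := by simp; linarith
  have hs12 : s ≠ 1 / 2 := by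
    rintro rfl
    norm_num at hs
    linarith
  have hG : Complex.Gamma s ≠ 0 := Complex.Gamma_ne_zero_of_re_pos (by linarith)
  have hE := zeta_mul_eisenstein (even_two_mul κ) z (s := s) (by linarith)
  have hcast : ((κ.natAbs : ℕ) : ℝ) = |(κ : ℝ)| := by
    rw [Nat.cast_natAbs, Int.cast_abs]
  have h1 := summable_whittakerTerm κ (Z := z) hz s
  have h2 := summable_whittakerTerm (-κ) hz' s
  have hzeta : Summable fun c : ℕ+ => 1 / ((c : ℕ) : ℂ) ^ (2 * s - 1) :=
    (Complex.summable_one_div_nat_cpow.2 hre).comp_injective PNat.coe_injective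
  have hzeta' : ∑' c : ℕ+, 1 / ((c : ℕ) : ℂ) ^ (2 * s - 1) = riemannZeta (2 * s - 1) := by
    rw [zeta_eq_tsum_one_div_nat_add_one_cpow hre,
      tsum_pnat_eq_tsum_succ (f := fun n : ℕ => 1 / (n : ℂ) ^ (2 * s - 1))]
    push_cast
    rfl
  have hS : (Real.pi : ℂ) ^ (-s) * Complex.Gamma (s + (κ.natAbs : ℕ)) * (z.im : ℂ) ^ s *
      ∑' c : ℕ+, ∑' d : ℤ, latticeTerm (2 * κ) s (((c : ℕ) : ℂ) * (z : ℂ) + d)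
      = (4 * Real.pi * z.im : ℂ) ^ (1 - s) * (-1) ^ κ *
          (Complex.Gamma (2 * s - 1) / Complex.Gamma (s - (κ.natAbs : ℕ))) *
            riemannZeta (2 * s - 1) + nonconstReg κ z s := by
    rw [← tsum_mul_left]
    simp only [completed_tsum_latticeTerm z hs]
    rw [Summable.tsum_add (hzeta.mul_left _)
      (((h1.prod.mul_left _).add (h2.prod.mul_left _)).mul_left _), tsum_mul_left, tsum_mul_left,
      Summable.tsum_add (h1.prod.mul_left _) (h2.prod.mul_left _), tsum_mul_left, tsum_mul_left,
      hzeta', ← h1.tsum_prod, ← h2.tsum_prod]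
    rfl
  have hY : (4 * Real.pi * z.im : ℂ) ^ (1 - s)
      = (4 * Real.pi : ℂ) ^ (1 - s) * (z.im : ℂ) ^ (1 - s) := by
    have := Complex.mul_cpow_ofReal_nonneg (a := 4 * Real.pi) (by positivity) hz.le (1 - s)
    simpa using this
  rw [constReg_eq _ _ hs12, thetaReg_one_sub κ.natAbs (by rw [hcast]; exact hs),
    ← Gamma_mul_zeta_eq_thetaReg _ hG, neg_one_pow_natAbs]
  rw [hY] at hS
  linear_combination ((Real.pi : ℂ) ^ (-s) * Complex.Gamma (s + (κ.natAbs : ℕ))) * hE + hS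

/-- The formula is known for Re s > |κ| + 1 only; both sides are holomorphic for Re s > 1, so the
identity theorem extends it there. -/
theorem isCompletedEisenstein_two_mul (κ : ℤ) (z : ℍ) :
    IsCompletedEisenstein (2 * κ) z
      (fun s => constReg κ.natAbs z.im s + nonconstReg κ z s) := by
  have hD : ∀ s ∈ continuationDomain (2 * κ),
      DifferentiableAt ℂ (fun s => constReg κ.natAbs z.im s + nonconstReg κ z s) s := by
    intro s hs
    refine (differentiableAt_constReg z.im_pos fun h => hs ?_).add
      (differentiable_nonconstReg κ z s)
    rw [Int.natAbs_eq_zero.1 h, mul_zero]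
  refine ⟨fun s hs => (hD s hs).differentiableWithinAt, fun s hs => ?_⟩
  have hne : ∀ s : ℂ, 1 < s.re → s ≠ 0 ∧ s ≠ 1 ∧ s ≠ 1 / 2 := by
    intro s hs
    refine ⟨?_, ?_, ?_⟩ <;> rintro rfl <;> norm_num at hs
  rw [thetaK_eq_thetaReg _ (fun _ => (hne s hs).1) (hne s hs).2.2, natAbs_two_mul_div_two]
  have hopen : IsOpen {s : ℂ | 1 < s.re} := isOpen_lt continuous_const Complex.continuous_re
  have hconn : IsPreconnected {s : ℂ | 1 < s.re} := (convex_halfSpace_re_gt 1).isPreconnected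
  have hL : DifferentiableOn ℂ (fun s => constReg κ.natAbs z.im s + nonconstReg κ z s)
      {s : ℂ | 1 < s.re} := fun s hs =>
    (hD s fun _ => ⟨(hne s hs).1, (hne s hs).2.1⟩).differentiableWithinAt
  have hR : DifferentiableOn ℂ (fun s => thetaReg κ.natAbs s * eisenstein (2 * κ) z s)
      {s : ℂ | 1 < s.re} := by
    refine DifferentiableOn.mul (fun s hs => ?_) (differentiableOn_eisenstein _ z)
    exact (differentiableAt_thetaReg (fun _ => (hne s hs).1)
      (hne s hs).2.2).differentiableWithinAt
  have habs := abs_nonneg (κ : ℝ)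
  have hmem : ((|(κ : ℝ)| + 2 : ℝ) : ℂ) ∈ {s : ℂ | 1 < s.re} := by
    rw [mem_ofPred_eq, Complex.ofReal_re]
    linarith
  refine (hL.analyticOnNhd hopen).eqOn_of_preconnected_of_eventuallyEq (hR.analyticOnNhd hopen)
    hconn hmem ?_ hs
  have hnhds : {s : ℂ | |(κ : ℝ)| + 1 < s.re} ∈ 𝓝 ((|(κ : ℝ)| + 2 : ℝ) : ℂ) := by
    refine (isOpen_lt continuous_const Complex.continuous_re).mem_nhds ?_
    rw [mem_ofPred_eq, Complex.ofReal_re]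
    linarith
  filter_upwards [hnhds] with w hw
  exact (thetaK_mul_eisenstein z hw).symm

theorem isCompletedEisenstein_completedEisenstein {k : ℤ} (hk : Even k) (z : ℍ) :
    IsCompletedEisenstein k z (completedEisenstein k z) := by
  obtain ⟨κ, rfl⟩ := hk.two_dvd
  have h : ∃ F : ℂ → ℂ, IsCompletedEisenstein (2 * κ) z F :=
    ⟨_, isCompletedEisenstein_two_mul κ z⟩
  rw [completedEisenstein, dif_pos h]
  exact h.choose_spec

theorem completedEisenstein_intCast {κ h : ℤ} (z : ℍ) (hdom : κ = 0 → h ≠ 0 ∧ h ≠ 1) :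
    completedEisenstein (2 * κ) z (h : ℂ)
      = thetaK (2 * κ) (h : ℂ) * (z.im : ℂ) ^ h + thetaK (2 * κ) (1 - (h : ℂ)) * (z.im : ℂ) ^ (1 - h)
        + nonconstReg κ z h := by
  have hmem : (h : ℂ) ∈ continuationDomain (2 * κ) := by
    intro hκ
    have := hdom (by simpa using hκ)
    exact ⟨by exact_mod_cast this.1, by exact_mod_cast this.2⟩
  -- `completedEisenstein` is a chosen continuation; uniqueness replaces it by the explicit one.
  rw [(isCompletedEisenstein_completedEisenstein (even_two_mul κ) z).eqOn
    (isCompletedEisenstein_two_mul κ z) hmem]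
  have h12 : ∀ n : ℤ, (n : ℂ) ≠ 1 / 2 := by
    intro n hn
    have h2 : ((2 * n : ℤ) : ℂ) = (1 : ℤ) := by
      push_cast
      linear_combination 2 * hn
    have : 2 * n = 1 := by exact_mod_cast h2
    omega
  have h12' := h12 (1 - h)
  push_cast at h12'
  have e1 : (z.im : ℂ) ^ (1 - (h : ℂ)) = (z.im : ℂ) ^ (1 - h) := by
    rw [← Complex.cpow_intCast]
    push_cast
    rfl
  simp only
  rw [constReg_eq _ _ (h12 h), thetaK_eq_thetaReg (2 * κ) (s := (h : ℂ)) ?_ (h12 h),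
    thetaK_eq_thetaReg (2 * κ) (s := 1 - (h : ℂ)) ?_ h12', natAbs_two_mul_div_two,
    Complex.cpow_intCast, e1]
  · intro hκ
    have := (hdom (by omega)).2
    rw [sub_ne_zero]
    exact_mod_cast this.symm
  · intro hκ
    have := (hdom (by omega)).1
    exact_mod_cast this

end NonholoEisenstein

/-! ### The coefficients: integrality, vanishing, factorisation. -/

namespace NonholoEisenstein
open MeasureTheory Set Filter Topology

theorem descPochhammer_eval_intCast (r : ℤ) (n : ℕ) :
    (descPochhammer ℂ n).eval (r : ℂ) = (n ! : ℂ) * ((Ring.choose r n : ℤ) : ℂ) := by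
  have h := Ring.descPochhammer_eq_factorial_smul_choose r n
  rw [← Polynomial.eval_eq_smeval, nsmul_eq_mul] at h
  rw [← descPochhammer_eval_cast, h]
  push_cast
  rfl

theorem ascPochhammer_eval_neg_intCast (r : ℤ) (n : ℕ) :
    (ascPochhammer ℂ n).eval (-(r : ℂ)) = (-1) ^ n * ((n ! : ℂ) * ((Ring.choose r n : ℤ) : ℂ)) := by
  rw [ascPochhammer_eval_neg_eq_descPochhammer, descPochhammer_eval_intCast]

theorem ascPochhammer_eval_add (n m : ℕ) (x : ℂ) :
    (ascPochhammer ℂ (n + m)).eval x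
      = (ascPochhammer ℂ n).eval x * (ascPochhammer ℂ m).eval (x + n) := by
  rw [← ascPochhammer_mul]
  simp

theorem descPochhammer_eval_add (n m : ℕ) (x : ℂ) :
    (descPochhammer ℂ (n + m)).eval x
      = (descPochhammer ℂ n).eval x * (descPochhammer ℂ m).eval (x - n) := by
  rw [← descPochhammer_mul]
  simp

theorem ringChoose_eq_zero_iff (r : ℤ) (n : ℕ) : Ring.choose r n = 0 ↔ 0 ≤ r ∧ r < n := by
  have h := Ring.descPochhammer_eq_factorial_smul_choose r n
  rw [← Polynomial.eval_eq_smeval, nsmul_eq_mul] at h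
  have h2 := ascPochhammer_eval_neg_eq_descPochhammer ℤ r n
  rw [h] at h2
  have h3 : ((n ! : ℕ) : ℤ) ≠ 0 := by positivity
  have h4 : ((-1 : ℤ)) ^ n ≠ 0 := by simp
  have h5 : Ring.choose r n = 0 ↔ (ascPochhammer ℤ n).eval (-r) = 0 := by
    rw [h2]
    simp [n.factorial_ne_zero]
  rw [h5, ascPochhammer_eval_eq_zero_iff]
  constructor
  · rintro ⟨k, hk, hkr⟩
    omega
  · rintro ⟨h0, hr⟩
    exact ⟨r.toNat, by omega, by omega⟩

theorem coeffA_of_nonneg {κ : ℤ} (hκ : 0 ≤ κ) (h : ℤ) (u : ℕ) :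
    coeffA (2 * κ) h u = (-1) ^ (u + κ.toNat) * (u ! : ℚ) * ((Ring.choose (κ + h - 1) u : ℤ) : ℚ) *
      ((Ring.choose (κ - h) u : ℤ) : ℚ) := by
  rw [coeffA, if_pos (by omega), show 2 * κ / 2 = κ by omega]
  congr 3
  rw [← zpow_natCast]
  congr 1
  omega

theorem coeffA_of_nonpos (p : ℕ) (h : ℤ) (u : ℕ) (hp : 0 < p) :
    coeffA (2 * -(p : ℤ)) h u = (-1) ^ u * (((u + p)! : ℚ) ^ 2 / (u ! : ℚ)) *
      ((Ring.choose (h - 1) (u + p) : ℤ) : ℚ) * ((Ring.choose (-h) (u + p) : ℤ) : ℚ) := by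
  have e : ((u : ℤ) - 2 * -(p : ℤ) / 2).toNat = u + p := by omega
  rw [coeffA, if_neg (by omega), e]

theorem exists_coeffA_eq_intCast (κ h : ℤ) (u : ℕ) : ∃ a : ℤ, coeffA (2 * κ) h u = a := by
  rcases le_or_gt 0 κ with hκ | hκ
  · refine ⟨(-1) ^ (u + κ.toNat) * (u ! : ℤ) * Ring.choose (κ + h - 1) u * Ring.choose (κ - h) u, ?_⟩
    rw [coeffA_of_nonneg hκ]
    push_cast
    rfl
  · obtain ⟨p, rfl⟩ : ∃ p : ℕ, κ = -(p : ℤ) := ⟨(-κ).toNat, by omega⟩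
    -- One of the two factors (u+p)! absorbs the denominator u!.
    obtain ⟨d, hd⟩ := Nat.factorial_dvd_factorial (Nat.le_add_right u p)
    refine ⟨(-1) ^ u * ((u + p)! * d : ℤ) * Ring.choose (h - 1) (u + p) *
      Ring.choose (-h) (u + p), ?_⟩
    rw [coeffA_of_nonpos p h u (by omega)]
    have hu : (u ! : ℚ) ≠ 0 := by positivity
    have e : ((u + p)! : ℚ) ^ 2 / (u ! : ℚ) = (u + p)! * d := by
      have : ((u + p)! : ℚ) = u ! * d := by exact_mod_cast hd
      rw [pow_two, mul_div_assoc]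
      congr 1
      rw [this]
      field_simp
    rw [e]
    push_cast
    rfl

/-- For κ ≥ 0 the upper entries are κ+h* and κ-1-h* in some order. The first binomial is nonzero for
u ≤ κ+h*; the second vanishes iff 0 ≤ κ-1-h* < u. For κ = -p < 0 the upper entries are h* ≥ u+p and
-1-h* < 0, so nothing vanishes. -/
theorem coeffA_eq_zero_iff {κ h : ℤ} {u : ℕ} (hu : (u : ℤ) ≤ hStar h + κ) :
    coeffA (2 * κ) h u = 0 ↔ hStar h < κ ∧ κ - 1 - hStar h < (u : ℤ) := by
  rcases le_or_gt 0 κ with hκ | hκ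
  · have h1 : ((u ! : ℕ) : ℚ) ≠ 0 := by positivity
    rw [coeffA_of_nonneg hκ]
    simp only [mul_eq_zero, pow_eq_zero_iff', neg_eq_zero, one_ne_zero, false_and, false_or, h1,
      Int.cast_eq_zero, ringChoose_eq_zero_iff]
    unfold hStar at hu ⊢
    split_ifs at hu ⊢ <;> omega
  · obtain ⟨p, rfl⟩ : ∃ p : ℕ, κ = -(p : ℤ) := ⟨(-κ).toNat, by omega⟩
    have h1 : ((u ! : ℕ) : ℚ) ≠ 0 := by positivity
    have h2 : (((u + p)! : ℕ) : ℚ) ≠ 0 := by positivity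
    rw [coeffA_of_nonpos p h u (by omega)]
    simp only [mul_eq_zero, pow_eq_zero_iff', neg_eq_zero, one_ne_zero, false_and, false_or, h1, h2,
      div_eq_zero_iff, or_false, Int.cast_eq_zero, ringChoose_eq_zero_iff]
    unfold hStar at hu ⊢
    split_ifs at hu ⊢ <;> push_cast <;> omega

/-- For κ ≥ 0 the quotient is 1. For κ = -p it is (h-p)_p (h)_p: the first factor extends the
falling factorial of h-p-1 to one of h-1 of length u+p, the second extends (h+p)_u to (h)_(u+p).
This explains the squared factorial over u!. -/
theorem gammaQuot_mul_eq_coeffA (κ h : ℤ) (u : ℕ) :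
    gammaQuot κ h * (-1) ^ κ * (((Ring.choose (h + κ - 1) u : ℤ) : ℂ) *
      (ascPochhammer ℂ u).eval ((h - κ : ℤ) : ℂ)) = (coeffA (2 * κ) h u : ℂ) := by
  rcases le_or_gt 0 κ with hκ | hκ
  · have e : ((h - κ : ℤ) : ℂ) = -((κ - h : ℤ) : ℂ) := by push_cast; ring
    have e0 : (|κ| - κ).toNat = 0 := by rw [abs_of_nonneg hκ]; simp
    rw [coeffA_of_nonneg hκ, gammaQuot, e0, e, ascPochhammer_eval_neg_intCast,
      show h + κ - 1 = κ + h - 1 by ring, ascPochhammer_zero, Polynomial.eval_one]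
    have e1 : ((-1 : ℂ)) ^ κ = (-1) ^ κ.toNat := by
      rw [← zpow_natCast, Int.toNat_of_nonneg hκ]
    rw [e1]
    push_cast
    ring
  · obtain ⟨p, rfl⟩ : ∃ p : ℕ, κ = -(p : ℤ) := ⟨(-κ).toNat, by omega⟩
    have e0 : (|(-(p : ℤ))| - -(p : ℤ)).toNat = p + p := by
      rw [abs_neg, Nat.abs_cast]
      omega
    have hu : (u ! : ℂ) ≠ 0 := by exact_mod_cast u.factorial_ne_zero
    have hD1 := descPochhammer_eval_intCast (h - 1) (u + p)
    have hD2 := ascPochhammer_eval_neg_intCast (-h) (u + p)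
    have hD3 := descPochhammer_eval_intCast (h + -(p : ℤ) - 1) u
    rw [add_comm u p, descPochhammer_eval_add, descPochhammer_eval_eq_ascPochhammer] at hD1
    rw [add_comm u p, ascPochhammer_eval_add] at hD2
    rw [coeffA_of_nonpos p h u (by omega), gammaQuot, e0, ascPochhammer_eval_add]
    have e1 : ((-1 : ℂ)) ^ (-(p : ℤ)) = (-1) ^ p := by
      rw [zpow_neg, zpow_natCast, ← inv_pow, inv_neg, inv_one]
    have hsq : ((-1 : ℂ) ^ p) * (-1) ^ p = 1 := by
      rw [← mul_pow]
      norm_num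
    rw [e1]
    push_cast at hD1 hD2 hD3 ⊢
    rw [show (h : ℂ) - 1 - p + 1 = h + -p by ring, show (h : ℂ) - 1 - p = h + -p - 1 by ring] at hD1
    rw [neg_neg] at hD2
    rw [show (h : ℂ) + -p + p = h by ring, show (h : ℂ) - -p = h + p by ring, add_comm u p]
    rw [hD3] at hD1
    set A := (ascPochhammer ℂ p).eval ((h : ℂ) + -p)
    set B := (ascPochhammer ℂ p).eval (h : ℂ)
    set E := (ascPochhammer ℂ u).eval ((h : ℂ) + p)
    set c₁ := ((Ring.choose (h + -(p : ℤ) - 1) u : ℤ) : ℂ)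
    set c₂ := ((Ring.choose (h - 1) (p + u) : ℤ) : ℂ)
    set c₃ := ((Ring.choose (-h) (p + u) : ℤ) : ℂ)
    rw [pow_add] at hD2
    field_simp
    linear_combination (-1) ^ p * B * E * hD1 + (-1) ^ p * ((p + u)! * c₂) * hD2 +
      (-1) ^ u * ((p + u)! * c₂) * ((p + u)! * c₃) * hsq

end NonholoEisenstein

/-! ### The Fourier expansion at integers. -/

namespace NonholoEisenstein
open MeasureTheory Set Filter Topology

noncomputable section

/-- The `m`-th Fourier term at `Z` with the full inner sum. -/
def fourierTerm (κ h : ℤ) (Z : ℂ) (m : ℕ+) : ℂ :=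
  divisorPowerSum (2 * h - 1) m / (m : ℂ) ^ h *
    Complex.exp (2 * Real.pi * Complex.I * (m : ℂ) * Z) *
    innerSum (2 * κ) h (hStar h + κ) (4 * Real.pi * (m : ℝ) * Z.im)

end

/-- The factors run through the integers from h+κ ≤ 0 to h-κ-1 ≥ 0, so one of them is 0. This is
exactly the case in which the expansion of `tricomi` need not terminate. -/
theorem gammaQuot_intCast_eq_zero {κ h : ℤ} (h₁ : κ < h) (h₂ : h + κ ≤ 0) :
    gammaQuot κ h = 0 := by
  rw [gammaQuot, ascPochhammer_eval_eq_zero_iff]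
  refine ⟨(-(h + κ)).toNat, ?_, ?_⟩
  · rw [abs_of_neg (by omega)]
    omega
  · have : (((-(h + κ)).toNat : ℤ) : ℂ) = ((-(h + κ) : ℤ) : ℂ) := by
      rw [Int.toNat_of_nonneg (by omega)]
    rw [← Int.cast_natCast, this]
    push_cast
    rfl

/-- At integers the Whittaker type function is elementary. -/
theorem gammaQuot_mul_tricomi_eq_innerSum (κ h : ℤ) {x : ℝ} (hx : 0 < x) :
    gammaQuot κ h * (-1) ^ κ * (x : ℂ) ^ h * tricomi ((h : ℂ) - κ) (h + κ - 1) x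
      = innerSum (2 * κ) h (hStar h + κ) x := by
  have hx0 : (x : ℂ) ≠ 0 := by exact_mod_cast hx.ne'
  by_cases hz : κ < h ∧ h + κ ≤ 0
  · have hN : (hStar h + κ + 1).toNat = 0 := by
      unfold hStar
      split_ifs <;> omega
    rw [gammaQuot_intCast_eq_zero hz.1 hz.2, innerSum, hN]
    simp
  -- The last index h*+κ is the larger of κ-h = -a and h+κ-1 = c, so it reaches the end of the
  -- expansion in either terminating case.
  · have hT := tricomi_eq_tricomiSum (a := h - κ) (c := h + κ - 1) (J := (hStar h + κ + 1).toNat)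
      (by
        unfold hStar
        split_ifs <;> omega) hx
    push_cast at hT
    rw [hT, tricomiSum, innerSum, Finset.mul_sum]
    refine Finset.sum_congr rfl fun j _ => ?_
    have hp : (x : ℂ) ^ (-(j : ℤ) + 2 * κ / 2) = (x : ℂ) ^ h * (x : ℂ) ^ (-(h - κ) - (j : ℤ)) := by
      rw [← zpow_add₀ hx0]
      congr 1
      omega
    rw [← gammaQuot_mul_eq_coeffA, hp]
    ring

theorem whittakerTerm_mul_eq (κ h : ℤ) {Z : ℂ} (hZ : 0 < Z.im) (p : ℕ+ × ℕ+) :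
    (4 * Real.pi * Z.im : ℂ) ^ h * (-1) ^ κ * gammaQuot κ h *
        whittakerTerm κ h ((p.1 : ℕ) * Z) p.2
      = ((p.2 : ℕ) : ℂ) ^ (2 * h - 1) / (((p.1 * p.2 : ℕ+) : ℕ) : ℂ) ^ h *
        Complex.exp (2 * Real.pi * Complex.I * ((p.1 * p.2 : ℕ+) : ℕ) * Z) *
        innerSum (2 * κ) h (hStar h + κ) (4 * Real.pi * ((p.1 * p.2 : ℕ+) : ℕ) * Z.im) := by
  obtain ⟨c, m⟩ := p
  have hpi := Real.pi_pos
  have hc : (0 : ℝ) < (c : ℕ) := by exact_mod_cast c.pos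
  have hm : (0 : ℝ) < (m : ℕ) := by exact_mod_cast m.pos
  have hc0 : ((c : ℕ) : ℂ) ≠ 0 := by exact_mod_cast c.ne_zero
  have hm0 : ((m : ℕ) : ℂ) ≠ 0 := by exact_mod_cast m.ne_zero
  have hx : 0 < 4 * Real.pi * ((m : ℕ) : ℝ) * (((c : ℕ) : ℂ) * Z).im := by
    simp only [Complex.mul_im, Complex.natCast_re, Complex.natCast_im, zero_mul, add_zero]
    positivity
  have hA := gammaQuot_mul_tricomi_eq_innerSum κ h hx
  have e1 : 4 * Real.pi * (((c * m : ℕ+) : ℕ) : ℝ) * Z.im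
      = 4 * Real.pi * ((m : ℕ) : ℝ) * (((c : ℕ) : ℂ) * Z).im := by
    simp
    ring
  have e2 : ((4 * Real.pi * ((m : ℕ) : ℝ) * (((c : ℕ) : ℂ) * Z).im : ℝ) : ℂ)
      = (4 * Real.pi * Z.im : ℂ) * (((c * m : ℕ+) : ℕ) : ℂ) := by
    rw [← e1]
    push_cast
    ring
  have e3 : (((m : ℕ) : ℂ)) ^ (2 * (h : ℂ) - 1) = ((m : ℕ) : ℂ) ^ (2 * h - 1) := by
    rw [← Complex.cpow_intCast]
    push_cast
    rfl
  have e4 : Complex.exp (2 * Real.pi * Complex.I * (((c : ℕ) : ℂ) * Z) * (m : ℕ))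
      = Complex.exp (2 * Real.pi * Complex.I * ((c * m : ℕ+) : ℕ) * Z) := by
    congr 1
    push_cast
    ring
  have hn0 : ((((c * m : ℕ+) : ℕ) : ℂ)) ≠ 0 := by exact_mod_cast (c * m).ne_zero
  simp only
  rw [e1, ← hA, whittakerTerm, e2, e3, e4, mul_zpow (4 * Real.pi * Z.im : ℂ) _ h]
  have hn1 := zpow_ne_zero h hn0
  generalize (4 * Real.pi * Z.im : ℂ) ^ h = Y
  field_simp

theorem summable_fourierTerm_aux (κ h : ℤ) {Z : ℂ} (hZ : 0 < Z.im) :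
    Summable fun p : ℕ+ × ℕ+ =>
      ((p.2 : ℕ) : ℂ) ^ (2 * h - 1) / (((p.1 * p.2 : ℕ+) : ℕ) : ℂ) ^ h *
        Complex.exp (2 * Real.pi * Complex.I * ((p.1 * p.2 : ℕ+) : ℕ) * Z) *
        innerSum (2 * κ) h (hStar h + κ) (4 * Real.pi * ((p.1 * p.2 : ℕ+) : ℕ) * Z.im) := by
  refine ((summable_whittakerTerm κ hZ h).mul_left
    ((4 * Real.pi * Z.im : ℂ) ^ h * (-1) ^ κ * gammaQuot κ h)).congr fun p => ?_
  exact whittakerTerm_mul_eq κ h hZ p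

/-- Regrouping the double sum according to the product `n = c m`. -/
theorem hasSum_fourierTerm (κ h : ℤ) {Z : ℂ} (hZ : 0 < Z.im) :
    HasSum (fourierTerm κ h Z)
      ((4 * Real.pi * Z.im : ℂ) ^ h * (-1) ^ κ * gammaQuot κ h * whittakerSum κ Z h) := by
  have hS := summable_fourierTerm_aux κ h hZ
  have hH := hS.hasSum
  rw [← tsum_congr (whittakerTerm_mul_eq κ h hZ), tsum_mul_left] at hH
  -- For fixed n = cm the only factor depending on the pair is m^(2h-1), and m runs over the
  -- divisors of n.
  have hσ := (sigmaAntidiagonalEquivProd.hasSum_iff.2 hH).sigma fun n => (hasSum_fintype _)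
  refine hσ.congr_fun fun n => ?_
  have hn : ∀ x : (n : ℕ).divisorsAntidiagonal,
      (sigmaAntidiagonalEquivProd ⟨n, x⟩).1 * (sigmaAntidiagonalEquivProd ⟨n, x⟩).2 = n := by
    intro x
    exact congrArg Sigma.fst (sigmaAntidiagonalEquivProd.symm_apply_apply ⟨n, x⟩)
  have hx2 : ∀ x : (n : ℕ).divisorsAntidiagonal,
      (((sigmaAntidiagonalEquivProd ⟨n, x⟩).2 : ℕ)) = x.1.2 := fun x => rfl
  simp only [Function.comp_apply, hn, hx2]
  rw [← Finset.sum_mul, ← Finset.sum_mul, ← Finset.sum_div, fourierTerm, divisorPowerSum]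
  congr 3
  rw [Finset.sum_coe_sort (n : ℕ).divisorsAntidiagonal (fun x : ℕ × ℕ => (x.2 : ℂ) ^ (2 * h - 1)),
    Nat.sum_divisorsAntidiagonal' (f := fun _ x => (x : ℂ) ^ (2 * h - 1))]

theorem innerSum_eq_of_coeffA_eq_zero {k h N N' : ℤ} (hN : N' ≤ N)
    (hzero : ∀ u : ℕ, N' < u → (u : ℤ) ≤ N → coeffA k h u = 0) (x : ℝ) :
    innerSum k h N' x = innerSum k h N x := by
  rw [innerSum, innerSum]
  refine Finset.sum_subset (Finset.range_mono (by omega)) fun u hu hu' => ?_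
  rw [Finset.mem_range] at hu hu'
  rw [hzero u (by omega) (by omega)]
  simp

theorem posTerm_eq_fourierTerm (κ h : ℤ) (z : ℍ) :
    posTerm (2 * κ) h (hStar h + κ) z = fourierTerm κ h z := rfl

/-- The reflection z ↦ -conj z preserves y and turns e^(2πimz) into the exponential of the second
series. -/
theorem negTerm_eq_fourierTerm (κ h : ℤ) (z : ℍ) :
    negTerm (2 * κ) h (hStar h - κ) z = fourierTerm (-κ) h (-(starRingEnd ℂ) (z : ℂ)) := by
  ext m
  have him : (-(starRingEnd ℂ) (z : ℂ)).im = z.im := by simp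
  rw [negTerm, fourierTerm, him, mul_neg 2 κ, mul_neg, ← sub_eq_add_neg (hStar h)]

theorem hasFourierExpansion_full {κ h : ℤ} (hdom : κ = 0 → h ≠ 0 ∧ h ≠ 1) (z : ℍ) :
    HasFourierExpansion (2 * κ) h (hStar h + κ) (hStar h - κ) z := by
  have hz' : 0 < (-(starRingEnd ℂ) (z : ℂ)).im := by simpa using z.im_pos
  have h1 := hasSum_fourierTerm κ h (Z := z) z.im_pos
  have h2 := hasSum_fourierTerm (-κ) h hz'
  rw [← posTerm_eq_fourierTerm] at h1
  rw [← negTerm_eq_fourierTerm] at h2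
  refine ⟨h1.summable, h2.summable, ?_⟩
  rw [completedEisenstein_intCast z hdom, add_assoc, h1.tsum_eq, h2.tsum_eq, nonconstReg,
    Complex.cpow_intCast]
  have him : (-(starRingEnd ℂ) (z : ℂ)).im = z.im := by simp
  have hsgn : ((-1 : ℂ)) ^ (-κ) = (-1) ^ κ := by
    rw [← neg_one_pow_natAbs, ← neg_one_pow_natAbs, Int.natAbs_neg]
  rw [him, hsgn, UpperHalfPlane.coe_im]
  ring

theorem HasFourierExpansion.of_innerSum_eq {k h N₁ N₂ N₁' N₂' : ℤ} {z : ℍ}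
    (H : HasFourierExpansion k h N₁ N₂ z) (h₁ : ∀ x, innerSum k h N₁' x = innerSum k h N₁ x)
    (h₂ : ∀ x, innerSum (-k) h N₂' x = innerSum (-k) h N₂ x) :
    HasFourierExpansion k h N₁' N₂' z := by
  have e1 : posTerm k h N₁' z = posTerm k h N₁ z := by
    ext m
    simp only [posTerm, h₁]
  have e2 : negTerm k h N₂' z = negTerm k h N₂ z := by
    ext m
    simp only [negTerm, h₂]
  unfold HasFourierExpansion
  rw [e1, e2]
  exact H

theorem hStar_nonneg (h : ℤ) : 0 ≤ hStar h := by
  unfold hStar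
  split_ifs <;> omega

theorem innerSum_reduced {κ h : ℤ} (hlt : hStar h < κ) (x : ℝ) :
    innerSum (2 * κ) h (κ - 1 - hStar h) x = innerSum (2 * κ) h (hStar h + κ) x := by
  have := hStar_nonneg h
  exact innerSum_eq_of_coeffA_eq_zero (by omega)
    (fun u hu hu' => (coeffA_eq_zero_iff hu').2 ⟨hlt, hu⟩) x

end NonholoEisenstein

theorem theorem1p2 (k h : ℤ) (hk : Even k) (h₀ : (h, k) ≠ (0, 0)) (h₁ : (h, k) ≠ (1, 0)) :
    -- `E*_k(z, s)` is defined: convergence for `Re s > 1` and analytic continuation in `s`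
    (∀ z : UpperHalfPlane,
      (∀ s : ℂ, 1 < s.re → Summable (eisensteinCosetTerm k z s)) ∧
      IsCompletedEisenstein k z (completedEisenstein k z)) ∧
    -- the Fourier expansion
    (∀ z : UpperHalfPlane, HasFourierExpansion k h (hStar h + k / 2) (hStar h - k / 2) z) ∧
    -- the coefficients are integers
    (∀ u : ℕ, (∃ a : ℤ, coeffA k h u = a) ∧ (∃ b : ℤ, coeffA (-k) h u = b)) ∧
    -- the cases in which an upper limit may be reduced
    (hStar h < k / 2 → ∀ z : UpperHalfPlane,
      HasFourierExpansion k h (k / 2 - 1 - hStar h) (hStar h - k / 2) z) ∧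
    (hStar h < -(k / 2) → ∀ z : UpperHalfPlane,
      HasFourierExpansion k h (hStar h + k / 2) (-(k / 2) - 1 - hStar h) z) ∧
    -- no other reduction is possible: exactly these coefficients vanish
    (∀ u : ℕ, (u : ℤ) ≤ hStar h + k / 2 →
      (coeffA k h u = 0 ↔ hStar h < k / 2 ∧ k / 2 - 1 - hStar h < (u : ℤ))) ∧
    (∀ u : ℕ, (u : ℤ) ≤ hStar h - k / 2 →
      (coeffA (-k) h u = 0 ↔ hStar h < -(k / 2) ∧ -(k / 2) - 1 - hStar h < (u : ℤ))) := by
  obtain ⟨κ, rfl⟩ := hk.two_dvd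
  have hdom : κ = 0 → h ≠ 0 ∧ h ≠ 1 := by
    rintro rfl
    exact ⟨fun e => h₀ (by simp [e]), fun e => h₁ (by simp [e])⟩
  have hdiv : 2 * κ / 2 = κ := by omega
  have hneg : -(2 * κ) = 2 * -κ := by ring
  rw [hdiv]
  refine ⟨fun z => ⟨fun s hs => summable_eisensteinCosetTerm (2 * κ) z hs,
    isCompletedEisenstein_completedEisenstein hk z⟩, hasFourierExpansion_full hdom,
    fun u => ⟨exists_coeffA_eq_intCast κ h u, hneg ▸ exists_coeffA_eq_intCast (-κ) h u⟩,
    fun hlt z => (hasFourierExpansion_full hdom z).of_innerSum_eq (innerSum_reduced hlt)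
      fun _ => rfl,
    fun hlt z => (hasFourierExpansion_full hdom z).of_innerSum_eq (fun _ => rfl) fun x => ?_,
    fun u hu => coeffA_eq_zero_iff hu, fun u hu => ?_⟩
  -- The second inner sum is the first one with -κ in place of κ.
  · rw [hneg, sub_eq_add_neg (hStar h)]
    exact innerSum_reduced hlt x
  · rw [hneg]
    exact coeffA_eq_zero_iff (by rwa [← sub_eq_add_neg])
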